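/- Let $n\ge 1$, let $x_1,\dots,x_n$ be the coordinates of $X=\mathbb A^n_{\mathbb C}$, let $D\subset X$ be the hyperplane $x_n=0$ and $U=X\setminus D$. Let $\delta_{in}=1$ if $i=n$ and $\delta_{in}=0$ otherwise. Let $\mathcal M$ be a connection on $X$ meromorphic along $D$, i.e. a coherent $\mathcal O_X[1/x_n]$-module with an integrable connection, and let $\rho\ge 0$ and $a\ge 1$ be integers with $a\ge\rho$ (for example, $\rho$ may be the generic Poincaré–Katz rank of $\mathcal M$ along $D$ if this rank is an integer). *The dilatation.* Let $(X*X)^{(a)}$ be the spectrum of the quotient of $\mathbb C[x_i,t_i,u^{\pm1},y_i]_{1\le i\le n}$ by the relations $x_n=ut_n$, $u-1=t_n^ay_n$ and $x_k-t_k=t_n^ay_k$ $(k<n)$, that is, of $\mathbb C[t_1,\dots,t_n,y_1,\dots,y_n][1/(1+t_n^ay_n)]$ with $x_i=t_i+t_n^{a+\delta_{in}}y_i$. The open subset $t_n\ne0$ is $U\times U$, with inclusion $j_a:U\times U\to (X*X)^{(a)}$; the first projection $p_1:U\times U\to U$ is given by $(x_i)$ and the second projection $p_2$ by $(t_i)$.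 Put $$H_a(\mathcal M)=j_{a+}\,\mathcal Hom(p_2^+\mathcal M,p_1^+\mathcal M).$$ The scheme $(X*X)^{(a)}$ is an open subset of the trivial vector bundle $X\times\mathbb A^n\to X$, $(t,y)\mapsto t$, and contains its fibres over $D$. *Property $L$.* Let $E=\operatorname{Spec}\mathbb C[[t_1,\dots,t_n]][y_1,\dots,y_l]$ and let $E_O\subset E$ be the closed fibre $t_1=\dots=t_n=0$. A $\mathcal D$-module $M$ on $E$ has property $L$ if on some Zariski open neighbourhood of $E_O$ in $E$ it is generated as a $\mathcal D$-module by finitely many sections $e_1,\dots,e_m$ such that $\partial_{y_i}e_j=\sum_u f_{iju}e_u$ for all $i,j$, where each $f_{iju}$ is a quotient $g/q$ with $g,q\in\mathbb C[[t]][y]$, $q$ invertible on this neighbourhood, and where, in each of the expansions $g=\sum_\nu P_\nu(y)t^\nu$ and $q=\sum_\nu Q_\nu(y)t^\nu$, every non-zero coefficient has total degree in $y$ at most $\nu_1+\dots+\nu_n$. A $\mathcal D$-module defined on an open neighbourhood of the fibre over $x\in X$ in the bundle $X\times\mathbb A^n$ has property $L$ at $x$ if its base change to $\operatorname{Spec}\widehat{\mathcal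 O}_{X,x}$ has property $L$, where $\widehat{\mathcal O}_{X,x}$ is identified with $\mathbb C[[t_1,\dots,t_n]]$ by means of the coordinates centred at $x$. *Statement.* Suppose that every point of $X$ has a Zariski open neighbourhood $V$ such that $\mathcal M|_V$ is generated as a $\mathcal D_V$-module by a coherent $\mathcal O_V$-submodule which is stable under the operators $x_n^{\rho+\delta_{in}}\partial_{x_i}$, $i=1,\dots,n$. Then $H_a(\mathcal M)$ has property $L$ at every point $x\in D$. -/

import Mathlib

open scoped TensorProduct

noncomputable section

/-!
All the varieties that occur are affine and smooth over `ℂ`. A quasi-coherent `𝒟`-module on such a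
variety is given by its module of global sections over the ring of functions `R`, together with the
action of a family of derivations of `R` which freely generate the vector fields (the `∂/∂x_i`
attached to coordinates `x_i`); stability under `𝒟` is stability under `R` and these derivations.
-/

/-! ### Rings with derivations -/

section Derivations

variable {R : Type*} [CommRing R] [Algebra ℂ R]

/-- The map `r ↦ r + d(r) ε` from `R` to the dual numbers over `R[1/f]`. -/
def dualNumberHom (f : R) (d : Derivation ℂ R R) :
    R →+* TrivSqZeroExt (Localization.Away f) (Localization.Away f) where
  toFun r := TrivSqZeroExt.inl (algebraMap R (Localization.Away f) r) +
    TrivSqZeroExt.inr (algebraMap R (Localization.Away f) (d r))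
  map_one' := by
    apply TrivSqZeroExt.ext <;> simp [-algebraMap_smul]
  map_zero' := by
    apply TrivSqZeroExt.ext <;> simp
  map_add' r s := by
    apply TrivSqZeroExt.ext <;> simp [-algebraMap_smul]
  map_mul' r s := by
    apply TrivSqZeroExt.ext <;> simp [-algebraMap_smul, mul_comm]

theorem isUnit_dualNumberHom (f : R) (d : Derivation ℂ R R) : IsUnit (dualNumberHom f d f) := by
  rw [TrivSqZeroExt.isUnit_iff_isUnit_fst]
  have h : (dualNumberHom f d f).fst = algebraMap R (Localization.Away f) f := by
    simp [dualNumberHom]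
  rw [h]
  exact IsLocalization.Away.algebraMap_isUnit f

/-- The map `s ↦ s + d(s) ε` from `R[1/f]` to the dual numbers over `R[1/f]`. -/
def awayDualNumberHom (f : R) (d : Derivation ℂ R R) :
    Localization.Away f →+* TrivSqZeroExt (Localization.Away f) (Localization.Away f) :=
  IsLocalization.Away.lift f (isUnit_dualNumberHom f d)

theorem awayDualNumberHom_algebraMap (f : R) (d : Derivation ℂ R R) (r : R) :
    awayDualNumberHom f d (algebraMap R (Localization.Away f) r) = dualNumberHom f d r :=
  IsLocalization.Away.lift_eq f (isUnit_dualNumberHom f d) r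

theorem fst_awayDualNumberHom (f : R) (d : Derivation ℂ R R) (s : Localization.Away f) :
    (awayDualNumberHom f d s).fst = s := by
  have h : ((TrivSqZeroExt.fstHom ℂ (Localization.Away f) (Localization.Away f)).toRingHom.comp
      (awayDualNumberHom f d)) = RingHom.id _ := by
    apply IsLocalization.ringHom_ext (Submonoid.powers f)
    ext r
    simp [awayDualNumberHom_algebraMap, dualNumberHom]
  exact congrArg (fun g => g s) h

/-- The unique extension of a derivation of `R` to a derivation of `R[1/f]`. -/
def awayDerivation (f : R) (d : Derivation ℂ R R) :
    Derivation ℂ (Localization.Away f) (Localization.Away f) :=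
  Derivation.mk'
    { toFun := fun s => (awayDualNumberHom f d s).snd
      map_add' := fun s t => by simp
      map_smul' := fun c s => by
        have hc : (awayDualNumberHom f d (algebraMap ℂ _ c)).snd = 0 := by
          rw [IsScalarTower.algebraMap_apply ℂ R (Localization.Away f),
            awayDualNumberHom_algebraMap]
          simp [dualNumberHom]
        simp [Algebra.smul_def, hc, fst_awayDualNumberHom] }
    (fun s t => by simp [fst_awayDualNumberHom, mul_comm])

theorem awayDerivation_algebraMap (f : R) (d : Derivation ℂ R R) (r : R) :
    awayDerivation f d (algebraMap R (Localization.Away f) r) = algebraMap R _ (d r) := by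
  change (awayDualNumberHom f d (algebraMap R _ r)).snd = _
  rw [awayDualNumberHom_algebraMap]
  simp [-algebraMap_smul, dualNumberHom]

/-- The action of a derivation on the coefficients of a polynomial. -/
def coeffDerivationFun (l : ℕ) (d : Derivation ℂ R R) (p : MvPolynomial (Fin l) R) :
    MvPolynomial (Fin l) R :=
  ∑ μ ∈ p.support, MvPolynomial.monomial μ (d (MvPolynomial.coeff μ p))

theorem coeff_coeffDerivationFun (l : ℕ) (d : Derivation ℂ R R) (p : MvPolynomial (Fin l) R)
    (μ : Fin l →₀ ℕ) :
    MvPolynomial.coeff μ (coeffDerivationFun l d p) = d (MvPolynomial.coeff μ p) := by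
  classical
  simp only [coeffDerivationFun, MvPolynomial.coeff_sum, MvPolynomial.coeff_monomial]
  rw [Finset.sum_ite_eq']
  split_ifs with h
  · rfl
  · rw [MvPolynomial.notMem_support_iff.mp h, map_zero]

/-- The extension of a derivation of `R` to `R[y_1, …, y_l]` which kills the `y_i`: it acts on the
coefficients. -/
def coeffDerivation (l : ℕ) (d : Derivation ℂ R R) :
    Derivation ℂ (MvPolynomial (Fin l) R) (MvPolynomial (Fin l) R) :=
  Derivation.mk'
    { toFun := coeffDerivationFun l d
      map_add' := fun p q => by
        ext μ
        simp [coeff_coeffDerivationFun]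
      map_smul' := fun c p => by
        ext μ
        simp [coeff_coeffDerivationFun] }
    (fun p q => by
      classical
      ext μ
      simp only [LinearMap.coe_mk, AddHom.coe_mk, coeff_coeffDerivationFun, smul_eq_mul,
        MvPolynomial.coeff_add]
      rw [mul_comm q, MvPolynomial.coeff_mul, MvPolynomial.coeff_mul, MvPolynomial.coeff_mul,
        map_sum, ← Finset.sum_add_distrib]
      refine Finset.sum_congr rfl fun x _ => ?_
      simp only [coeff_coeffDerivationFun, Derivation.leibniz, smul_eq_mul]
      ring)

end Derivations

/-! ### Connections -/

section Connections

variable {ι κ R S : Type*} [CommRing R] [Algebra ℂ R] [CommRing S] [Algebra ℂ S]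

/-- A connection on the `R`-module `M`, given by the additive operators `∇_i` of covariant
derivation along the derivations `d i` of `R`. -/
structure Connection (d : ι → Derivation ℂ R R) (M : Type*) [AddCommGroup M] [Module R M] where
  nabla : ι → M →+ M
  leibniz : ∀ i (r : R) (m : M), nabla i (r • m) = d i r • m + r • nabla i m

/-- The operators `∇_i` commute: for commuting `d i`, this is integrability, and makes `M` a
`𝒟`-module. -/
def Connection.IsIntegrable {d : ι → Derivation ℂ R R} {M : Type*} [AddCommGroup M] [Module R M]
    (D : Connection d M) : Prop :=
  ∀ i j m, D.nabla i (D.nabla j m) = D.nabla j (D.nabla i m)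

/-- The subset `s` of `M` generates `M` as a `𝒟`-module: `M` is the only `R`-submodule which
contains `s` and is stable under the `∇_i`. -/
def Connection.Generates {d : ι → Derivation ℂ R R} {M : Type*} [AddCommGroup M] [Module R M]
    (D : Connection d M) (s : Set M) : Prop :=
  ∀ N : Submodule R M, s ⊆ N → (∀ i, ∀ m ∈ N, D.nabla i m ∈ N) → N = ⊤

/-- The connection induced on `Hom_R(M, N)`: `(∇_i u)(m) = ∇_i (u m) - u (∇_i m)`. -/
def Connection.hom {d : ι → Derivation ℂ R R} {M N : Type*} [AddCommGroup M] [Module R M]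
    [AddCommGroup N] [Module R N] (D : Connection d M) (D' : Connection d N) :
    Connection d (M →ₗ[R] N) where
  nabla i :=
    { toFun := fun u =>
        { toFun := fun m => D'.nabla i (u m) - u (D.nabla i m)
          map_add' := fun m m' => by
            simp only [map_add]
            abel
          map_smul' := fun r m => by
            simp only [map_smul, D.leibniz, D'.leibniz, map_add, RingHom.id_apply, smul_sub]
            abel }
      map_zero' := by
        ext m
        simp
      map_add' := fun u v => by
        ext m
        simp only [LinearMap.add_apply, map_add, LinearMap.coe_mk, AddHom.coe_mk]
        abel }
  leibniz i r u := by
    ext m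
    simp only [AddMonoidHom.coe_mk, ZeroHom.coe_mk, LinearMap.coe_mk, AddHom.coe_mk,
      LinearMap.smul_apply, LinearMap.add_apply, D'.leibniz, smul_sub]
    abel

/-- A morphism `Spec S → Spec R` together with the expression of its differential in the chosen
bases of vector fields: `θ_k (φ r) = ∑_i J_{k i} φ (d_i r)`. -/
structure DiffMap [Fintype ι] (d : ι → Derivation ℂ R R) (θ : κ → Derivation ℂ S S) where
  toAlgHom : R →ₐ[ℂ] S
  jac : κ → ι → S
  chain : ∀ k r, θ k (toAlgHom r) = ∑ i, jac k i * toAlgHom (d i r)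

/-- The inverse image `S ⊗_R M` of the `R`-module `M` under `φ : R → S`. -/
def InverseImage (φ : R →ₐ[ℂ] S) (M : Type*) [AddCommGroup M] [Module R M] : Type _ :=
  letI := φ.toRingHom.toAlgebra
  S ⊗[R] M

instance (φ : R →ₐ[ℂ] S) (M : Type*) [AddCommGroup M] [Module R M] :
    AddCommGroup (InverseImage φ M) :=
  letI := φ.toRingHom.toAlgebra
  TensorProduct.addCommGroup (R := R) (M := S) (N := M)

instance (φ : R →ₐ[ℂ] S) (M : Type*) [AddCommGroup M] [Module R M] :
    Module S (InverseImage φ M) :=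
  letI := φ.toRingHom.toAlgebra
  TensorProduct.leftModule (R := R) (R'' := S) (M := S) (N := M)

/-- The element `s ⊗ m` of the inverse image. -/
def InverseImage.tmul (φ : R →ₐ[ℂ] S) {M : Type*} [AddCommGroup M] [Module R M] (s : S) (m : M) :
    InverseImage φ M :=
  letI := φ.toRingHom.toAlgebra
  s ⊗ₜ[R] m

section InverseImage

variable (φ : R →ₐ[ℂ] S) {M : Type*} [AddCommGroup M] [Module R M]

theorem InverseImage.add_tmul (s s' : S) (m : M) :
    tmul φ (s + s') m = tmul φ s m + tmul φ s' m :=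
  letI := φ.toRingHom.toAlgebra
  TensorProduct.add_tmul s s' m

theorem InverseImage.tmul_add (s : S) (m m' : M) :
    tmul φ s (m + m') = tmul φ s m + tmul φ s m' :=
  letI := φ.toRingHom.toAlgebra
  TensorProduct.tmul_add s m m'

theorem InverseImage.smul_tmul (s s' : S) (m : M) :
    s • tmul φ s' m = tmul φ (s * s') m :=
  rfl

theorem InverseImage.tmul_smul (s : S) (r : R) (m : M) :
    tmul φ s (r • m) = tmul φ (φ r * s) m :=
  letI := φ.toRingHom.toAlgebra
  (TensorProduct.smul_tmul r s m).symm

theorem InverseImage.induction {p : InverseImage φ M → Prop} (z : InverseImage φ M)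
    (h0 : p 0) (ht : ∀ s m, p (tmul φ s m)) (ha : ∀ x y, p x → p y → p (x + y)) : p z :=
  letI := φ.toRingHom.toAlgebra
  TensorProduct.induction_on z h0 ht ha

/-- The map out of the inverse image defined by a balanced biadditive map. -/
def InverseImage.lift {P : Type*} [AddCommGroup P] (f : S →+ M →+ P)
    (hf : ∀ r s m, f (φ r * s) m = f s (r • m)) : InverseImage φ M →+ P :=
  letI := φ.toRingHom.toAlgebra
  TensorProduct.liftAddHom f hf

theorem InverseImage.lift_tmul {P : Type*} [AddCommGroup P] (f : S →+ M →+ P)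
    (hf : ∀ r s m, f (φ r * s) m = f s (r • m)) (s : S) (m : M) :
    lift φ f hf (tmul φ s m) = f s m :=
  rfl

/-- `s ⊗ m`, as a biadditive map. -/
def InverseImage.tmulHom : S →+ M →+ InverseImage φ M :=
  AddMonoidHom.mk' (fun s => AddMonoidHom.mk' (tmul φ s) (tmul_add φ s))
    (fun s s' => AddMonoidHom.ext fun m => add_tmul φ s s' m)

theorem InverseImage.tmulHom_apply (s : S) (m : M) : tmulHom φ s m = tmul φ s m := rfl

end InverseImage

variable [Fintype ι] {d : ι → Derivation ℂ R R} {θ : κ → Derivation ℂ S S}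

/-- The operator `s ⊗ m ↦ θ_k(s) ⊗ m + ∑_i s J_{k i} ⊗ ∇_i m` on the inverse image. -/
def Connection.inverseImageNabla {M : Type*} [AddCommGroup M] [Module R M] (D : Connection d M)
    (f : DiffMap d θ) (k : κ) :
    InverseImage f.toAlgHom M →+ InverseImage f.toAlgHom M :=
  InverseImage.lift f.toAlgHom
    (AddMonoidHom.mk'
      (fun s => AddMonoidHom.mk'
        (fun m => InverseImage.tmul f.toAlgHom (θ k s) m +
          ∑ i, InverseImage.tmul f.toAlgHom (s * f.jac k i) (D.nabla i m))
        (fun m m' => by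
          simp only [InverseImage.tmul_add, map_add, Finset.sum_add_distrib]
          abel))
      (fun s s' => by
        ext m
        simp only [AddMonoidHom.mk'_apply, AddMonoidHom.add_apply, map_add, add_mul,
          InverseImage.add_tmul, Finset.sum_add_distrib]
        abel))
    (fun r s m => by
      simp only [AddMonoidHom.mk'_apply, D.leibniz, InverseImage.tmul_add,
        InverseImage.tmul_smul, Derivation.leibniz, f.chain, smul_eq_mul,
        InverseImage.add_tmul, Finset.sum_add_distrib]
      have h : InverseImage.tmul f.toAlgHom (s * ∑ i, f.jac k i * f.toAlgHom (d i r)) m =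
          ∑ i, InverseImage.tmul f.toAlgHom (f.toAlgHom (d i r) * (s * f.jac k i)) m := by
        rw [Finset.mul_sum]
        simp only [← InverseImage.tmulHom_apply, map_sum, AddMonoidHom.finsetSum_apply]
        refine Finset.sum_congr rfl fun i _ => ?_
        congr 2
        ring
      rw [h]
      simp only [mul_assoc]
      abel)

/-- The inverse image of a `𝒟`-module (as an `𝒪`-module, it is the inverse image of the
underlying `𝒪`-module). -/
def Connection.inverseImage {M : Type*} [AddCommGroup M] [Module R M] (D : Connection d M)
    (f : DiffMap d θ) : Connection θ (InverseImage f.toAlgHom M) where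
  nabla := D.inverseImageNabla f
  leibniz k s z := by
    have ht : ∀ s m, D.inverseImageNabla f k (InverseImage.tmul f.toAlgHom s m) =
        InverseImage.tmul f.toAlgHom (θ k s) m +
          ∑ i, InverseImage.tmul f.toAlgHom (s * f.jac k i) (D.nabla i m) := fun s m => rfl
    induction z using InverseImage.induction with
    | h0 => simp
    | ht s' m =>
      simp only [InverseImage.smul_tmul, ht, Derivation.leibniz, smul_eq_mul,
        InverseImage.add_tmul, smul_add, Finset.smul_sum, mul_assoc]
      rw [mul_comm s' (θ k s)]
      abel
    | ha x y hx hy =>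
      simp only [smul_add, map_add, hx, hy]
      abel

/-- A morphism under which the chosen vector fields correspond to each other. -/
def DiffMap.ofCompatible [DecidableEq ι] {θ : ι → Derivation ℂ S S} (φ : R →ₐ[ℂ] S)
    (h : ∀ i r, θ i (φ r) = φ (d i r)) : DiffMap d θ where
  toAlgHom := φ
  jac k i := if k = i then 1 else 0
  chain k r := by simp [h]

/-- The inclusion of the open subset `f ≠ 0`. -/
def DiffMap.away [DecidableEq ι] (d : ι → Derivation ℂ R R) (f : R) :
    DiffMap d (fun i => awayDerivation f (d i)) :=
  DiffMap.ofCompatible (IsScalarTower.toAlgHom ℂ R (Localization.Away f))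
    (fun i r => awayDerivation_algebraMap f (d i) r)

/-- The direct image of an `S`-module under `Spec S → Spec R`. -/
def DirectImage (_φ : R →ₐ[ℂ] S) (N : Type*) : Type _ := N

instance (φ : R →ₐ[ℂ] S) (N : Type*) [AddCommGroup N] : AddCommGroup (DirectImage φ N) :=
  inferInstanceAs (AddCommGroup N)

instance (φ : R →ₐ[ℂ] S) (N : Type*) [AddCommGroup N] [Module S N] :
    Module R (DirectImage φ N) :=
  Module.compHom N φ.toRingHom

/-- The direct image `j_+` of a `𝒟`-module by an affine open immersion `j : Spec S → Spec R`: the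
same module with the same derivations, over the smaller ring `R`. -/
def Connection.directImage {θ : ι → Derivation ℂ S S} {N : Type*} [AddCommGroup N] [Module S N]
    (D : Connection θ N) (φ : R →ₐ[ℂ] S) (h : ∀ i r, θ i (φ r) = φ (d i r)) :
    Connection d (DirectImage φ N) where
  nabla := D.nabla
  leibniz i r n := by
    have := D.leibniz i (φ r) n
    rw [h] at this
    exact this

end Connections

/-! ### Coordinates -/

/-- The ring of functions of `𝔸^n`. -/
abbrev AffineRing (n : ℕ) := MvPolynomial (Fin n) ℂ

/-- The ring of functions `ℂ[t_1, …, t_n, y_1, …, y_l]` of the trivial vector bundle of rank `l` on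
`𝔸^n`; the coordinates `t_i` of the base are indexed by `Sum.inl i`, the linear coordinates `y_i`
of the fibres by `Sum.inr i`. -/
abbrev BundleRing (n l : ℕ) := MvPolynomial (Fin n ⊕ Fin l) ℂ

/-- A morphism from `Spec S` to an affine space, given by its coordinate functions. -/
def DiffMap.ofPoly {σ κ S : Type*} [Fintype σ] [CommRing S] [Algebra ℂ S]
    (θ : κ → Derivation ℂ S S) (c : σ → S) :
    DiffMap (fun i : σ => MvPolynomial.pderiv (R := ℂ) i) θ where
  toAlgHom := MvPolynomial.aeval c
  jac k i := θ k (c i)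
  chain k r := by
    classical
    induction r using MvPolynomial.induction_on with
    | C a =>
      rw [← MvPolynomial.algebraMap_eq, AlgHom.commutes]
      simp
    | add p q hp hq =>
      simp only [map_add, hp, hq, mul_add, Finset.sum_add_distrib]
    | mul_X p i hp =>
      simp only [map_mul, MvPolynomial.aeval_X, Derivation.leibniz, hp, smul_eq_mul, map_add,
        MvPolynomial.pderiv_X, mul_add, Finset.sum_add_distrib, Finset.mul_sum]
      congr 1
      · rw [Finset.sum_eq_single i]
        · simp [mul_comm]
        · intro j _ hj
          simp [hj.symm]
        · simp
      · exact Finset.sum_congr rfl fun j _ => by ring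

/-- The ring of functions `ℂ⟦t_1, …, t_n⟧[y_1, …, y_l]` of the trivial vector bundle `E` of rank `l`
on `Spec ℂ⟦t_1, …, t_n⟧`. -/
abbrev FormalBundleRing (n l : ℕ) := MvPolynomial (Fin l) (MvPowerSeries (Fin n) ℂ)

/-- The derivations `∂/∂t_i` (acting on the coefficients) and `∂/∂y_i` of
`ℂ⟦t_1, …, t_n⟧[y_1, …, y_l]`. -/
def formalDerivation (n l : ℕ) :
    Fin n ⊕ Fin l → Derivation ℂ (FormalBundleRing n l) (FormalBundleRing n l) :=
  Sum.elim (fun i => coeffDerivation l (MvPowerSeries.pderiv ℂ i))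
    (fun i => (MvPolynomial.pderiv i).restrictScalars ℂ)

/-- The base change along `Spec (completed local ring of 𝔸^n at x) → 𝔸^n`, the completed local
ring being identified with `ℂ⟦t_1, …, t_n⟧` by the coordinates centred at `x`. -/
def completionMap (n l : ℕ) (x : Fin n → ℂ) :
    DiffMap (fun i : Fin n ⊕ Fin l => MvPolynomial.pderiv (R := ℂ) i) (formalDerivation n l) :=
  DiffMap.ofPoly (formalDerivation n l)
    (Sum.elim (fun i => MvPolynomial.C (MvPowerSeries.C (x i) + MvPowerSeries.X i))
      (fun i => MvPolynomial.X i))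

/-! ### Property `L` -/

/-- In the expansion `g = ∑_ν P_ν(y) t^ν`, the total degree of each nonzero `P_ν` is at most
`|ν|`. -/
def HasSmallDegree {n l : ℕ} (g : FormalBundleRing n l) : Prop :=
  ∀ (ν : Fin n →₀ ℕ) (μ : Fin l →₀ ℕ),
    MvPowerSeries.coeff ν (MvPolynomial.coeff μ g) ≠ 0 → μ.degree ≤ ν.degree

/-- Property `L` for a `𝒟`-module `M` on the trivial vector bundle `E` of rank `l` on
`Spec ℂ⟦t_1, …, t_n⟧`. The function `h` defines the neighbourhood `h ≠ 0` of the closed fibre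
`E_O`, given by `t = 0`; such neighbourhoods are cofinal among all open neighbourhoods of `E_O`. -/
def Connection.PropertyL {n l : ℕ} {M : Type*} [AddCommGroup M] [Module (FormalBundleRing n l) M]
    (D : Connection (formalDerivation n l) M) : Prop :=
  ∃ h : FormalBundleRing n l,
    IsUnit (MvPolynomial.map (MvPowerSeries.constantCoeff (σ := Fin n) (R := ℂ)) h) ∧
    ∃ (m : ℕ) (e : Fin m → InverseImage (DiffMap.away (formalDerivation n l) h).toAlgHom M),
      (D.inverseImage (DiffMap.away (formalDerivation n l) h)).Generates (Set.range e) ∧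
      ∃ f : Fin l → Fin m → Fin m → Localization.Away h,
        (∀ i j u, ∃ g q : FormalBundleRing n l, HasSmallDegree g ∧ HasSmallDegree q ∧
          IsUnit (algebraMap _ (Localization.Away h) q) ∧
          f i j u * algebraMap _ (Localization.Away h) q = algebraMap _ (Localization.Away h) g) ∧
        ∀ i j, (D.inverseImage (DiffMap.away (formalDerivation n l) h)).nabla (Sum.inr i) (e j) =
          ∑ u, f i j u • e u

/-- Property `L` at the point `x` of `𝔸^n`, for a `𝒟`-module on the trivial vector bundle of rank
`l` on `𝔸^n`. -/
def Connection.PropertyLAt {n l : ℕ} {M : Type*} [AddCommGroup M] [Module (BundleRing n l) M]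
    (D : Connection (fun i : Fin n ⊕ Fin l => MvPolynomial.pderiv (R := ℂ) i) M)
    (x : Fin n → ℂ) : Prop :=
  (D.inverseImage (completionMap n l x)).PropertyL

/-! ### Meromorphic connections

The dimension is `n + 1`, and the divisor is the hyperplane `x_{n+1} = 0`, that is, the zero set of
the coordinate of index `Fin.last n`. -/

/-- `M` is a connection on `𝔸^{n+1}` meromorphic along the hyperplane `x_{n+1} = 0`: an integrable
connection on a coherent module over `𝒪[1/x_{n+1}]`. -/
structure Connection.IsMeromorphic {n : ℕ} {M : Type*} [AddCommGroup M]
    [Module (AffineRing (n + 1)) M]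
    (D : Connection (fun i : Fin (n + 1) => MvPolynomial.pderiv (R := ℂ) i) M) : Prop where
  integrable : D.IsIntegrable
  bijective : Function.Bijective
    fun m : M => (MvPolynomial.X (Fin.last n) : AffineRing (n + 1)) • m
  coherent : ∃ s : Finset M, ∀ m : M, ∃ k : ℕ,
    (MvPolynomial.X (Fin.last n) : AffineRing (n + 1)) ^ k • m ∈
      Submodule.span (AffineRing (n + 1)) (s : Set M)

/-- The exponent `a + δ_{i n}`, where the last index is called `n`. -/
def poleExponent {n : ℕ} (a : ℕ) (i : Fin (n + 1)) : ℕ := if i = Fin.last n then a + 1 else a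

/-- Locally (on a neighbourhood `f ≠ 0` of each point), `M` is generated as a `𝒟`-module by a
coherent `𝒪`-submodule which is stable under the operators `x_n ^ (ρ + δ_{i n}) ∂_{x_i}`, where
the last index is called `n`. -/
def Connection.IsLocallyGeneratedBounded {n : ℕ} {M : Type*} [AddCommGroup M]
    [Module (AffineRing (n + 1)) M]
    (D : Connection (fun i : Fin (n + 1) => MvPolynomial.pderiv (R := ℂ) i) M) (ρ : ℕ) : Prop :=
  ∀ x : Fin (n + 1) → ℂ, ∃ f : AffineRing (n + 1), MvPolynomial.eval x f ≠ 0 ∧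
    ∃ N : Submodule (Localization.Away f) (InverseImage (DiffMap.away
        (fun i : Fin (n + 1) => MvPolynomial.pderiv (R := ℂ) i) f).toAlgHom M),
      N.FG ∧ (D.inverseImage (DiffMap.away _ f)).Generates (N : Set _) ∧
      ∀ i, ∀ m ∈ N,
        algebraMap (AffineRing (n + 1)) (Localization.Away f)
            (MvPolynomial.X (Fin.last n) ^ poleExponent ρ i) •
          (D.inverseImage (DiffMap.away _ f)).nabla i m ∈ N

/-! ### The dilatation

Again the last index is called `n`. Let `(x_i)` and `(t_i)` be the coordinates of the first and
second factor of `𝔸 × 𝔸`. The ring of functions of `(𝔸 * 𝔸)^{(a)}` is the quotient of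
`ℂ[x_i, t_i, u, u⁻¹, y_1, …, y_n]` by the relations `x_n = u t_n`, `u - 1 = t_n ^ a y_n` and
`x_k - t_k = t_n ^ a y_k` for `k < n`. Elimination of `u` and of the `x_i` identifies it with
`ℂ[t_i, y_i]` localized at `u = 1 + t_n ^ a y_n`, so that `(𝔸 * 𝔸)^{(a)}` is an open subset of the
trivial vector bundle over the second factor `𝔸` with linear coordinates `y_i`, and this open
subset contains all fibres over the divisor `t_n = 0`. -/

section Dilatation

variable (n a : ℕ)

/-- The function `u = 1 + t_n ^ a y_n`. -/
def dilatationUnit : BundleRing (n + 1) (n + 1) :=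
  1 + MvPolynomial.X (Sum.inl (Fin.last n)) ^ a * MvPolynomial.X (Sum.inr (Fin.last n))

/-- The ring of functions of the dilatation `(𝔸 * 𝔸)^{(a)}`. -/
abbrev DilatationRing := Localization.Away (dilatationUnit n a)

/-- The derivations `∂/∂t_i` and `∂/∂y_i` on the dilatation. -/
def dilatationDerivation (i : Fin (n + 1) ⊕ Fin (n + 1)) :
    Derivation ℂ (DilatationRing n a) (DilatationRing n a) :=
  awayDerivation (dilatationUnit n a) (MvPolynomial.pderiv i)

/-- The inclusion of the dilatation in the trivial vector bundle. -/
def dilatationMap : BundleRing (n + 1) (n + 1) →ₐ[ℂ] DilatationRing n a :=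
  IsScalarTower.toAlgHom ℂ _ _

/-- The coordinate `t_i` of the second factor, as a function on the dilatation. -/
def secondCoord (i : Fin (n + 1)) : DilatationRing n a :=
  dilatationMap n a (MvPolynomial.X (Sum.inl i))

/-- The coordinate `x_i = t_i + t_n ^ (a + δ_{i n}) y_i` of the first factor, as a function on the
dilatation. -/
def firstCoord (i : Fin (n + 1)) : DilatationRing n a :=
  dilatationMap n a (MvPolynomial.X (Sum.inl i) +
    MvPolynomial.X (Sum.inl (Fin.last n)) ^ poleExponent a i * MvPolynomial.X (Sum.inr i))

/-- The ring of functions of `U × U`, where `U` is the complement of the divisor: it is the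
complement of `t_n = 0` in the dilatation. -/
abbrev OpenRing := Localization.Away (secondCoord n a (Fin.last n))

/-- The derivations `∂/∂t_i` and `∂/∂y_i` on `U × U`. -/
def openDerivation (i : Fin (n + 1) ⊕ Fin (n + 1)) :
    Derivation ℂ (OpenRing n a) (OpenRing n a) :=
  awayDerivation (secondCoord n a (Fin.last n)) (dilatationDerivation n a i)

/-- The open immersion `j_a` of `U × U` in the dilatation. -/
def openMap : DilatationRing n a →ₐ[ℂ] OpenRing n a :=
  IsScalarTower.toAlgHom ℂ _ _

/-- The first projection `U × U → U ⊆ 𝔸`. -/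
def firstProj :
    DiffMap (fun i : Fin (n + 1) => MvPolynomial.pderiv (R := ℂ) i) (openDerivation n a) :=
  DiffMap.ofPoly (openDerivation n a) (fun i => openMap n a (firstCoord n a i))

/-- The second projection `U × U → U ⊆ 𝔸`. -/
def secondProj :
    DiffMap (fun i : Fin (n + 1) => MvPolynomial.pderiv (R := ℂ) i) (openDerivation n a) :=
  DiffMap.ofPoly (openDerivation n a) (fun i => openMap n a (secondCoord n a i))

variable {n} {M : Type*} [AddCommGroup M] [Module (AffineRing (n + 1)) M]
  (D : Connection (fun i : Fin (n + 1) => MvPolynomial.pderiv (R := ℂ) i) M)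

/-- The connection `H_a(M) = j_{a+} Hom(p_2^+ M, p_1^+ M)` on the dilatation. -/
def Connection.dilatationHom :
    Connection (dilatationDerivation n a)
      (DirectImage (openMap n a)
        (InverseImage (secondProj n a).toAlgHom M →ₗ[OpenRing n a]
          InverseImage (firstProj n a).toAlgHom M)) :=
  ((D.inverseImage (secondProj n a)).hom (D.inverseImage (firstProj n a))).directImage
    (openMap n a) (fun i r => awayDerivation_algebraMap _ (dilatationDerivation n a i) r)

/-- Property `L` at the point `x` of the divisor, for a `𝒟`-module on the dilatation. As this
property only involves a neighbourhood of the fibre over `x`, which is contained in the dilatation,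
the `𝒟`-module is viewed on the whole vector bundle by direct image. -/
def Connection.DilatationPropertyLAt {P : Type*} [AddCommGroup P] [Module (DilatationRing n a) P]
    (D : Connection (dilatationDerivation n a) P) (x : Fin (n + 1) → ℂ) : Prop :=
  (D.directImage (d := fun i : Fin (n + 1) ⊕ Fin (n + 1) => MvPolynomial.pderiv (R := ℂ) i)
    (dilatationMap n a)
    (fun i r => awayDerivation_algebraMap _ (MvPolynomial.pderiv i) r)).PropertyLAt x

end Dilatation

end

/-! ### Representations of the Weyl algebra and Bernstein's inequality -/

section WeylAction

open MvPolynomial Module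

/-! The proof finds one finite family that both generates `H_a(M)` under `𝒟` near the fibre over `x`
and has a connection matrix in the `y`-directions with coefficients of small degree.

Let `A` (`dilatationSubalgebra`) be the subring generated by the `t_i`, the `t_n ^ (a + δ_{in}) y_i`
and `t_n ^ a y_n`. It is noetherian, it is stable under the `∂/∂y_i`, and it contains `u` and every
polynomial in the first coordinates `x_i`. At a point with `t_n = 0` all its elements have small
degree, because each `y` is accompanied by at least one factor `t_n`; this uses `a ≥ 1`. It
therefore suffices to find generators whose `A`-span is stable under the `∂/∂y_i` up to powers of a
function `g ∈ A` invertible on the fibre (`Connection.propertyLAt_of_generators`). The function used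
is `g = f(x_1, …, x_n) u`, where `f ≠ 0` is the neighbourhood in the hypothesis on `M`.

By the chain rule `∂/∂y_i` acts on sections pulled back by `p_1` as `t_n ^ (a + δ_{in}) ∂_{x_i}`.
Since `x_n = u t_n` and `ρ ≤ a`, the `A`-span `P` of the pulled back bounded lattice is stable under
`g ^ k ∂/∂y_i` for a suitable `k`. Sections pulled back by `p_2` are killed by the `∂/∂y_i`. Hence
the homomorphisms sending finitely many generators of `p_2^+ M` into `P` form an `A`-module `Λ` with
the same stability, finitely generated because `A` is noetherian. The function `t_n` is invertible
on `U × U` and killed by the `∂/∂y_i`, so every `t_n ^ (-N) Λ` is just as good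
(`exists_generators_of_lattice`).

These modules exhaust `H_a(M)` once `g` is inverted. A single `N` suffices because `H_a(M)` is
generated by a finite set under `𝒟`. This last fact is proved in the manner of Bernstein: a
filtration by pole order and degree has dimensions growing like `j ^ m` in `m` variables
(`Connection.exists_finset_generates`), whereas by Bernstein's inequality
(`IsFiltration.pow_le_finrank`) each strict enlargement of a submodule costs a definite amount of
that growth. -/

theorem MvPolynomial.exists_algHom_of_commute {K A σ : Type*} [CommRing K] [Ring A] [Algebra K A]
    (a : σ → A) (h : ∀ i j, Commute (a i) (a j)) :
    ∃ φ : MvPolynomial σ K →ₐ[K] A, ∀ i, φ (X i) = a i := by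
  have hc : ∀ x ∈ Set.range a, ∀ y ∈ Set.range a, x * y = y * x := by
    rintro _ ⟨i, rfl⟩ _ ⟨j, rfl⟩
    exact h i j
  have := Algebra.isMulCommutative_adjoin K hc
  let _ : CommRing (Algebra.adjoin K (Set.range a)) :=
    { (inferInstance : Ring (Algebra.adjoin K (Set.range a))) with
      mul_comm := fun x y => this.is_comm.comm x y }
  refine ⟨(Algebra.adjoin K (Set.range a)).val.comp
    (aeval fun i => ⟨a i, Algebra.subset_adjoin ⟨i, rfl⟩⟩), fun i => ?_⟩
  simp

/-- Operators `z i` and `d i` on a vector space which satisfy the relations of the coordinates and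
the partial derivatives in the Weyl algebra. -/
structure WeylAction (K σ V : Type*) [Field K] [AddCommGroup V] [Module K V] where
  z : σ → End K V
  d : σ → End K V
  comm_z : ∀ i j, Commute (z i) (z j)
  comm_d : ∀ i j, Commute (d i) (d j)
  comm_self : ∀ i, d i * z i - z i * d i = 1
  comm_ne : ∀ i j, i ≠ j → Commute (d i) (z j)

namespace WeylAction

variable {K σ V : Type*} [Field K] [AddCommGroup V] [Module K V] (ω : WeylAction K σ V)

/-- A subspace stable under all the operators. -/
def IsStable (N : Submodule K V) : Prop :=
  ∀ i, ∀ v ∈ N, ω.z i v ∈ N ∧ ω.d i v ∈ N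

/-- The action of the polynomials in the `z i`. -/
noncomputable def zHom : MvPolynomial σ K →ₐ[K] End K V :=
  (exists_algHom_of_commute ω.z ω.comm_z).choose

/-- The action of the polynomials in the `d i`. -/
noncomputable def dHom : MvPolynomial σ K →ₐ[K] End K V :=
  (exists_algHom_of_commute ω.d ω.comm_d).choose

@[simp] theorem zHom_X (i : σ) : ω.zHom (X i) = ω.z i :=
  (exists_algHom_of_commute ω.z ω.comm_z).choose_spec i

@[simp] theorem dHom_X (i : σ) : ω.dHom (X i) = ω.d i :=
  (exists_algHom_of_commute ω.d ω.comm_d).choose_spec i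

/-- Both sides are derivations in `p` along the algebra map `zHom`, so the variables decide. -/
theorem d_zHom (i : σ) (p : MvPolynomial σ K) :
    ω.d i * ω.zHom p - ω.zHom p * ω.d i = ω.zHom (pderiv i p) := by
  classical
  induction p using MvPolynomial.induction_on with
  | C a =>
    rw [← MvPolynomial.algebraMap_eq, AlgHom.commutes, Algebra.commutes]
    simp
  | add p q hp hq =>
    rw [map_add, map_add, map_add, ← hp, ← hq]
    noncomm_ring
  | mul_X p j hp =>
    have hj : ω.d i * ω.z j - ω.z j * ω.d i = ω.zHom (pderiv i (X j)) := by
      by_cases hij : i = j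
      · subst hij
        simp [ω.comm_self]
      · rw [pderiv_X_of_ne (Ne.symm hij), map_zero, (ω.comm_ne i j hij).eq, sub_self]
    rw [Derivation.leibniz, smul_eq_mul, smul_eq_mul, mul_comm (X j), map_add, map_mul, map_mul,
      map_mul, ← hj, ← hp, zHom_X]
    noncomm_ring

theorem dHom_z (i : σ) (p : MvPolynomial σ K) :
    ω.dHom p * ω.z i - ω.z i * ω.dHom p = ω.dHom (pderiv i p) := by
  classical
  induction p using MvPolynomial.induction_on with
  | C a =>
    rw [← MvPolynomial.algebraMap_eq, AlgHom.commutes, Algebra.commutes]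
    simp
  | add p q hp hq =>
    rw [map_add, map_add, map_add, ← hp, ← hq]
    noncomm_ring
  | mul_X p j hp =>
    have hj : ω.d j * ω.z i - ω.z i * ω.d j = ω.dHom (pderiv i (X j)) := by
      by_cases hij : j = i
      · subst hij
        simp [ω.comm_self]
      · rw [pderiv_X_of_ne hij, map_zero, (ω.comm_ne j i hij).eq, sub_self]
    rw [Derivation.leibniz, smul_eq_mul, smul_eq_mul, mul_comm (X j), map_add, map_mul, map_mul,
      map_mul, ← hj, ← hp, dHom_X]
    noncomm_ring

/-- The operator with a given symbol, the `z i` being written to the left of the `d i`. -/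
noncomputable def op : MvPolynomial (σ ⊕ σ) K →ₗ[K] End K V :=
  (basisMonomials (σ ⊕ σ) K).constr K fun m =>
    ω.zHom (monomial (Finsupp.sumFinsuppEquivProdFinsupp m).1 1) *
      ω.dHom (monomial (Finsupp.sumFinsuppEquivProdFinsupp m).2 1)

theorem op_monomial (m : σ ⊕ σ →₀ ℕ) (c : K) :
    ω.op (monomial m c) = c • (ω.zHom (monomial (Finsupp.sumFinsuppEquivProdFinsupp m).1 1) *
      ω.dHom (monomial (Finsupp.sumFinsuppEquivProdFinsupp m).2 1)) := by
  have h : monomial m c = c • (basisMonomials (σ ⊕ σ) K) m := by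
    simp [smul_monomial]
  rw [h, map_smul, op, Basis.constr_basis]

/-- With the `z` written on the left, `d i` commutes with the right-hand factor of every monomial
and only differentiates the left-hand one. Such commutators, together with those in `op_z`, lower
the degree of a symbol, which is what makes the induction in `symbol_eq_zero` possible. -/
theorem d_op (i : σ) (p : MvPolynomial (σ ⊕ σ) K) :
    ω.d i * ω.op p - ω.op p * ω.d i = ω.op (pderiv (Sum.inl i) p) := by
  classical
  induction p using MvPolynomial.induction_on' with
  | add p q hp hq =>
    rw [map_add, map_add, map_add, ← hp, ← hq]
    noncomm_ring
  | monomial m c =>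
    have h1 : (Finsupp.sumFinsuppEquivProdFinsupp (m - Finsupp.single (Sum.inl i) 1)).1 =
        (Finsupp.sumFinsuppEquivProdFinsupp m).1 - Finsupp.single i 1 := by
      ext j
      simp [Finsupp.single_apply]
    have h2 : (Finsupp.sumFinsuppEquivProdFinsupp (m - Finsupp.single (Sum.inl i) 1)).2 =
        (Finsupp.sumFinsuppEquivProdFinsupp m).2 := by
      ext j
      simp
    have h3 : monomial ((Finsupp.sumFinsuppEquivProdFinsupp m).1 - Finsupp.single i 1)
        (m (Sum.inl i) : K) = (m (Sum.inl i) : K) •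
          monomial ((Finsupp.sumFinsuppEquivProdFinsupp m).1 - Finsupp.single i 1) 1 := by
      simp [smul_monomial]
    have h := ω.d_zHom i (monomial (Finsupp.sumFinsuppEquivProdFinsupp m).1 1)
    rw [pderiv_monomial, one_mul, Finsupp.fst_sumFinsuppEquivProdFinsupp, h3, map_smul] at h
    have hd : Commute (ω.d i) (ω.dHom (monomial (Finsupp.sumFinsuppEquivProdFinsupp m).2 1)) := by
      rw [← dHom_X]
      exact (Commute.all _ _).map ω.dHom
    rw [pderiv_monomial, op_monomial, op_monomial, h1, h2, mul_smul, ← smul_mul_assoc (m _ : K),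
      ← h, mul_smul_comm, smul_mul_assoc, ← smul_sub, sub_mul, mul_assoc, mul_assoc, mul_assoc,
      hd.eq]

theorem op_z (i : σ) (p : MvPolynomial (σ ⊕ σ) K) :
    ω.op p * ω.z i - ω.z i * ω.op p = ω.op (pderiv (Sum.inr i) p) := by
  classical
  induction p using MvPolynomial.induction_on' with
  | add p q hp hq =>
    rw [map_add, map_add, map_add, ← hp, ← hq]
    noncomm_ring
  | monomial m c =>
    have h1 : (Finsupp.sumFinsuppEquivProdFinsupp (m - Finsupp.single (Sum.inr i) 1)).2 =
        (Finsupp.sumFinsuppEquivProdFinsupp m).2 - Finsupp.single i 1 := by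
      ext j
      simp [Finsupp.single_apply]
    have h2 : (Finsupp.sumFinsuppEquivProdFinsupp (m - Finsupp.single (Sum.inr i) 1)).1 =
        (Finsupp.sumFinsuppEquivProdFinsupp m).1 := by
      ext j
      simp
    have h3 : monomial ((Finsupp.sumFinsuppEquivProdFinsupp m).2 - Finsupp.single i 1)
        (m (Sum.inr i) : K) = (m (Sum.inr i) : K) •
          monomial ((Finsupp.sumFinsuppEquivProdFinsupp m).2 - Finsupp.single i 1) 1 := by
      simp [smul_monomial]
    have h := ω.dHom_z i (monomial (Finsupp.sumFinsuppEquivProdFinsupp m).2 1)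
    rw [pderiv_monomial, one_mul, Finsupp.snd_sumFinsuppEquivProdFinsupp, h3, map_smul] at h
    have hd : Commute (ω.z i) (ω.zHom (monomial (Finsupp.sumFinsuppEquivProdFinsupp m).1 1)) := by
      rw [← zHom_X]
      exact (Commute.all _ _).map ω.zHom
    rw [pderiv_monomial, op_monomial, op_monomial, h1, h2, mul_smul, ← mul_smul_comm (m _ : K),
      ← h, mul_smul_comm, smul_mul_assoc, ← smul_sub, mul_sub, mul_assoc, ← mul_assoc (ω.z i),
      ← mul_assoc _ (ω.z i), hd.eq]

/-- A filtration by subspaces such that all the operators have degree at most one. -/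
structure IsFiltration (W : ℕ → Submodule K V) : Prop where
  mono : Monotone W
  z_mem : ∀ i j, ∀ v ∈ W j, ω.z i v ∈ W (j + 1)
  d_mem : ∀ i j, ∀ v ∈ W j, ω.d i v ∈ W (j + 1)

variable {ω} {W : ℕ → Submodule K V}

theorem monomial_apply_mem (φ : MvPolynomial σ K →ₐ[K] End K V)
    (h : ∀ i j, ∀ v ∈ W j, φ (X i) v ∈ W (j + 1)) (m : σ →₀ ℕ) :
    ∀ j, ∀ v ∈ W j, φ (monomial m 1) v ∈ W (j + m.degree) := by
  classical
  induction m using Finsupp.induction_linear with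
  | zero => simp
  | add p q hp hq =>
    intro j v hv
    have : (monomial (p + q) 1 : MvPolynomial σ K) = monomial p 1 * monomial q 1 := by
      simp [monomial_mul]
    rw [this, map_mul, map_add, add_comm p.degree, ← add_assoc]
    exact hp _ _ (hq _ _ hv)
  | single i k =>
    intro j v hv
    rw [Finsupp.degree_single, ← X_pow_eq_monomial, map_pow]
    induction k generalizing j v with
    | zero => simpa using hv
    | succ k ih =>
      rw [pow_succ, add_comm k, ← add_assoc]
      exact ih _ _ (h i j v hv)

variable [Fintype σ]

theorem IsFiltration.op_mem (hW : ω.IsFiltration W) {p : MvPolynomial (σ ⊕ σ) K} {j : ℕ}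
    (hp : p.totalDegree ≤ j) (k : ℕ) {v : V} (hv : v ∈ W k) : ω.op p v ∈ W (k + j) := by
  rw [p.as_sum, map_sum, LinearMap.sum_apply]
  refine Submodule.sum_mem _ fun m hm => ?_
  rw [op_monomial, LinearMap.smul_apply]
  refine Submodule.smul_mem _ _ (hW.mono ?_ (monomial_apply_mem ω.zHom
    (fun i j v hv => by rw [zHom_X]; exact hW.z_mem i j v hv) _ _ _ (monomial_apply_mem ω.dHom
    (fun i j v hv => by rw [dHom_X]; exact hW.d_mem i j v hv) _ _ _ hv)))
  have h := (le_totalDegree hm).trans hp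
  change m.degree ≤ j at h
  simp only [Finsupp.degree_eq_sum, Fintype.sum_sum_type,
    Finsupp.fst_sumFinsuppEquivProdFinsupp, Finsupp.snd_sumFinsuppEquivProdFinsupp] at h ⊢
  omega

variable [CharZero K]

/-- A coefficient of a nonconstant monomial reappears in some partial derivative multiplied by a
positive integer; characteristic zero enters here. -/
theorem _root_.MvPolynomial.eq_C_of_pderiv_eq_zero {τ : Type*} {p : MvPolynomial τ K}
    (h : ∀ i, pderiv i p = 0) : p = C (coeff 0 p) := by
  classical
  ext m
  rw [coeff_C]
  split_ifs with h0
  · rw [h0]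
  · obtain ⟨i, hi⟩ := Finsupp.ne_iff.mp (Ne.symm h0)
    have hle : Finsupp.single i 1 ≤ m := by
      rw [Finsupp.single_le_iff]
      exact Nat.one_le_iff_ne_zero.mpr hi
    have := coeff_pderiv p (i := i) (m - Finsupp.single i 1)
    rw [h i, coeff_zero, tsub_add_cancel_of_le hle] at this
    exact (mul_eq_zero.mp this.symm).resolve_right (Nat.cast_add_one_ne_zero _)

omit [CharZero K] in
theorem _root_.MvPolynomial.totalDegree_pderiv_le {τ : Type*} {p : MvPolynomial τ K} {j : ℕ}
    (hp : p.totalDegree ≤ j + 1) (i : τ) : (pderiv i p).totalDegree ≤ j := by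
  classical
  refine Finset.sup_le fun m hm => ?_
  change m.degree ≤ j
  rw [MvPolynomial.mem_support_iff, coeff_pderiv] at hm
  have h := (le_totalDegree (MvPolynomial.mem_support_iff.mpr (left_ne_zero_of_mul hm))).trans hp
  change (m + Finsupp.single i 1).degree ≤ _ at h
  rw [map_add, Finsupp.degree_single] at h
  omega

omit [Fintype σ] in
/-- An operator of order at most `j` which vanishes on `W j` has zero symbol. -/
theorem IsFiltration.symbol_eq_zero (hW : ω.IsFiltration W) {v : V} (hv : v ∈ W 0) (hv0 : v ≠ 0)
    (j : ℕ) : ∀ p : MvPolynomial (σ ⊕ σ) K, p.totalDegree ≤ j → (∀ w ∈ W j, ω.op p w = 0) →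
      p = 0 := by
  have hC : ∀ c : K, ω.op (C c) v = 0 → C (σ := σ ⊕ σ) c = 0 := by
    intro c hc
    rw [C_apply, op_monomial] at hc
    simpa [hv0] using hc
  induction j with
  | zero =>
    intro p hp h
    rw [totalDegree_eq_zero_iff_eq_C.mp (Nat.le_zero.mp hp)] at h ⊢
    exact hC _ (h v hv)
  | succ j ih =>
    intro p hp h
    -- A commutator of `op p` with a generator vanishes on `W j`, since both `W j` and its image
    -- under the generator lie in `W (j + 1)`. Its symbol is a partial derivative of `p`, of degree
    -- at most `j`.
    have hd : ∀ i, pderiv i p = 0 := by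
      intro i
      refine ih _ (totalDegree_pderiv_le hp i) fun w hw => ?_
      rcases i with i | i
      · rw [← d_op, LinearMap.sub_apply, Module.End.mul_apply, Module.End.mul_apply,
          h w (hW.mono j.le_succ hw), h _ (hW.d_mem i j w hw), map_zero, sub_zero]
      · rw [← op_z, LinearMap.sub_apply, Module.End.mul_apply, Module.End.mul_apply,
          h w (hW.mono j.le_succ hw), h _ (hW.z_mem i j w hw), map_zero, sub_zero]
    rw [eq_C_of_pderiv_eq_zero hd] at h ⊢
    exact hC _ (h v (hW.mono (Nat.zero_le _) hv))

theorem _root_.MvPolynomial.finrank_restrictDegree (τ K : Type*) [Fintype τ] [Field K] (l : ℕ) :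
    finrank K (restrictDegree τ K l) = (l + 1) ^ Fintype.card τ := by
  classical
  have e : {n : τ →₀ ℕ | ∀ i, n i ≤ l} ≃ (τ → Fin (l + 1)) :=
    { toFun := fun n i => ⟨n.1 i, Nat.lt_succ_of_le (n.2 i)⟩
      invFun := fun g => ⟨Finsupp.equivFunOnFinite.symm fun i => g i,
        fun i => Nat.le_of_lt_succ (g i).2⟩
      left_inv := fun n => by ext; rfl
      right_inv := fun g => rfl }
  rw [restrictDegree, finrank_eq_nat_card_basis (basisRestrictSupport K {n : τ →₀ ℕ | ∀ i, n i ≤ l}),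
    Nat.card_congr e, Nat.card_fun, Nat.card_eq_fintype_card, Nat.card_eq_fintype_card,
    Fintype.card_fin]

/-- Bernstein's inequality, by Joseph's argument. Write `m` for the number of variables. The symbols
of degree at most `l` in each of the `2m` variables embed into `Hom(W (2ml), W (4ml))`, so that `(l
+ 1) ^ (2m)` is at most `dim W (2ml) * dim W (4ml)`, hence at most the square of `dim W (4ml)`. -/
theorem IsFiltration.pow_le_finrank (hW : ω.IsFiltration W) [∀ j, FiniteDimensional K (W j)]
    {v : V} (hv : v ∈ W 0) (hv0 : v ≠ 0) (l : ℕ) :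
    (l + 1) ^ Fintype.card σ ≤ finrank K (W (4 * Fintype.card σ * l)) := by
  classical
  set m := Fintype.card σ with hm
  have hdeg : ∀ p ∈ restrictDegree (σ ⊕ σ) K l, p.totalDegree ≤ 2 * m * l := by
    intro p hp
    refine Finset.sup_le fun s hs => ?_
    change s.degree ≤ _
    rw [Finsupp.degree_eq_sum]
    refine (Finset.sum_le_card_nsmul _ _ l fun i _ => (mem_restrictDegree _ p l).mp hp s hs i).trans
      (le_of_eq ?_)
    rw [Finset.card_univ, Fintype.card_sum, ← hm]
    simp only [smul_eq_mul]
    ring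
  let F : restrictDegree (σ ⊕ σ) K l →ₗ[K] (W (2 * m * l) →ₗ[K] W (4 * m * l)) :=
    { toFun := fun p => (ω.op p.1).restrict fun v hv => by
        have := hW.op_mem (hdeg p.1 p.2) _ hv
        convert this using 2
        ring
      map_add' := fun p q => by ext; simp
      map_smul' := fun c p => by ext; simp }
  have hF : Function.Injective F := by
    rw [injective_iff_map_eq_zero]
    intro p hp
    refine Subtype.ext (hW.symbol_eq_zero hv hv0 _ p.1 (hdeg p.1 p.2) fun w hw => ?_)
    simpa [F] using congrArg (fun g => (g ⟨w, hw⟩ : V)) hp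
  have h1 := LinearMap.finrank_le_finrank_of_injective hF
  rw [finrank_restrictDegree, Module.finrank_linearMap, Fintype.card_sum, ← hm] at h1
  have h2 : finrank K (W (2 * m * l)) ≤ finrank K (W (4 * m * l)) :=
    Submodule.finrank_mono (hW.mono (by gcongr; norm_num))
  rw [pow_add] at h1
  exact Nat.mul_self_le_mul_self_iff.mp (h1.trans (Nat.mul_le_mul_right _ h2))

variable (ω) in
/-- The operators induced on the quotient by a stable subspace. -/
noncomputable def quotient {N : Submodule K V} (hN : ω.IsStable N) : WeylAction K σ (V ⧸ N) where
  z i := N.mapQ N (ω.z i) fun v hv => (hN i v hv).1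
  d i := N.mapQ N (ω.d i) fun v hv => (hN i v hv).2
  comm_z i j := by
    refine Submodule.linearMap_qext _ (LinearMap.ext fun v => ?_)
    simpa using congrArg (fun g => N.mkQ (g v)) (ω.comm_z i j).eq
  comm_d i j := by
    refine Submodule.linearMap_qext _ (LinearMap.ext fun v => ?_)
    simpa using congrArg (fun g => N.mkQ (g v)) (ω.comm_d i j).eq
  comm_self i := by
    refine Submodule.linearMap_qext _ (LinearMap.ext fun v => ?_)
    simpa using congrArg (fun g => N.mkQ (g v)) (ω.comm_self i)
  comm_ne i j h := by
    refine Submodule.linearMap_qext _ (LinearMap.ext fun v => ?_)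
    simpa using congrArg (fun g => N.mkQ (g v)) (ω.comm_ne i j h).eq

/-- This is Bernstein's inequality for the nonzero module `N' / N` with the filtration induced by
`W`, combined with additivity of dimensions. -/
theorem IsFiltration.finrank_inf_add_pow_le (hW : ω.IsFiltration W)
    [∀ j, FiniteDimensional K (W j)] {N N' : Submodule K V} (hN : ω.IsStable N)
    (hN' : ω.IsStable N') (h : N ≤ N') {v : V} (hv : v ∈ N') (hvN : v ∉ N) {k : ℕ}
    (hk : v ∈ W k) (l : ℕ) :
    finrank K (W (4 * Fintype.card σ * l + k) ⊓ N : Submodule K V) + (l + 1) ^ Fintype.card σ ≤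
      finrank K (W (4 * Fintype.card σ * l + k) ⊓ N' : Submodule K V) := by
  -- The shift by `k` places the class of `v` in step `0`, as Bernstein's inequality requires.
  let W' : ℕ → Submodule K (V ⧸ N) := fun j => (W (j + k) ⊓ N').map N.mkQ
  have hW' : (ω.quotient hN).IsFiltration W' := by
    refine ⟨fun i j hij => Submodule.map_mono (inf_le_inf_right _ (hW.mono (by omega))), ?_, ?_⟩
    · rintro i j _ ⟨w, hw, rfl⟩
      refine ⟨ω.z i w, ⟨?_, (hN' i w hw.2).1⟩, rfl⟩
      have := hW.z_mem i _ w hw.1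
      rwa [add_right_comm] at this
    · rintro i j _ ⟨w, hw, rfl⟩
      refine ⟨ω.d i w, ⟨?_, (hN' i w hw.2).2⟩, rfl⟩
      have := hW.d_mem i _ w hw.1
      rwa [add_right_comm] at this
  have hfin : ∀ j, FiniteDimensional K (W j ⊓ N' : Submodule K V) := fun j =>
    Submodule.finiteDimensional_of_le inf_le_left
  have hfin' : ∀ j, FiniteDimensional K (W' j) := fun j => by
    have := hfin (j + k)
    infer_instance
  have h1 := hW'.pow_le_finrank (v := N.mkQ v) ⟨v, ⟨by simpa using hk, hv⟩, rfl⟩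
    (by simpa using hvN) l
  set j := 4 * Fintype.card σ * l
  have h2 := LinearMap.finrank_range_add_finrank_ker (N.mkQ.domRestrict (W (j + k) ⊓ N'))
  rw [LinearMap.range_domRestrict, LinearMap.ker_domRestrict, Submodule.ker_mkQ] at h2
  change _ + finrank K (N.submoduleOf (W (j + k) ⊓ N')) = _ at h2
  have h3 : finrank K (W (j + k) ⊓ N : Submodule K V) ≤
      finrank K (N.submoduleOf (W (j + k) ⊓ N')) := by
    rw [← Submodule.finrank_map_subtype_eq, Submodule.submoduleOf, Submodule.map_comap_subtype]
    have := hfin (j + k)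
    have : FiniteDimensional K ((W (j + k) ⊓ N') ⊓ N : Submodule K V) :=
      Submodule.finiteDimensional_of_le inf_le_left
    exact Submodule.finrank_mono fun w hw => ⟨⟨hw.1, h hw.2⟩, hw.2⟩
  have h4 : finrank K (W' j) = finrank K ((W (j + k) ⊓ N').map N.mkQ) := rfl
  omega

/-- A representation of the Weyl algebra in `m` variables with an exhaustive filtration whose
dimension grows at most like `j ^ m` is finitely generated. -/
theorem IsFiltration.exists_finset_generates (hW : ω.IsFiltration W)
    [∀ j, FiniteDimensional K (W j)] (hex : ∀ v, ∃ j, v ∈ W j) {c : ℕ}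
    (hc : ∀ j, finrank K (W j) ≤ c * (j + 1) ^ Fintype.card σ) :
    ∃ s : Finset V, ∀ N : Submodule K V, ω.IsStable N → (s : Set V) ⊆ N → N = ⊤ := by
  classical
  by_contra! hcon
  set m := Fintype.card σ with hm
  -- If no finite set generates, `r` successive enlargements force every stable subspace containing
  -- a suitable finite set to grow at least like `r (l + 1) ^ m`.
  have key : ∀ r : ℕ, ∃ (s : Finset V) (k : ℕ), ∀ N : Submodule K V, ω.IsStable N →
      (s : Set V) ⊆ N → ∀ k' ≥ k, ∀ l,
        r * (l + 1) ^ m ≤ finrank K (W (4 * m * l + k') ⊓ N : Submodule K V) := by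
    intro r
    induction r with
    | zero => exact ⟨∅, 0, fun N _ _ k' _ l => by simp⟩
    | succ r ih =>
      obtain ⟨s, k, hs⟩ := ih
      obtain ⟨N₀, hN₀, hsN₀, hne⟩ := hcon s
      -- The smallest stable subspace containing `s`. It is proper, and adjoining a vector outside
      -- it to `s` gains one more `(l + 1) ^ m`.
      let N₁ : Submodule K V := sInf {N | ω.IsStable N ∧ (s : Set V) ⊆ N}
      have hN₁ : ω.IsStable N₁ := fun i v hv =>
        ⟨Submodule.mem_sInf.mpr fun N hN => (hN.1 i v (Submodule.mem_sInf.mp hv N hN)).1,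
          Submodule.mem_sInf.mpr fun N hN => (hN.1 i v (Submodule.mem_sInf.mp hv N hN)).2⟩
      have hsN₁ : (s : Set V) ⊆ N₁ := fun v hv =>
        Submodule.mem_sInf.mpr fun N hN => hN.2 hv
      have hne₁ : N₁ ≠ ⊤ := fun h => hne (top_le_iff.mp (h ▸ sInf_le ⟨hN₀, hsN₀⟩))
      obtain ⟨v, hv⟩ : ∃ v, v ∉ N₁ := by
        by_contra! hall
        exact hne₁ (eq_top_iff.mpr fun v _ => hall v)
      obtain ⟨k₁, hk₁⟩ := hex v
      refine ⟨insert v s, max k k₁, fun N hN hsN k' hk' l => ?_⟩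
      rw [Finset.coe_insert, Set.insert_subset_iff] at hsN
      have h1 := hs N₁ hN₁ hsN₁ k' ((le_max_left _ _).trans hk') l
      have h2 := hW.finrank_inf_add_pow_le hN₁ hN (sInf_le ⟨hN, hsN.2⟩) hsN.1 hv
        (hW.mono ((le_max_right _ _).trans hk') hk₁) l
      rw [← hm] at h2
      rw [add_mul, one_mul]
      omega
  -- With `l = k` the relevant step is `W (4mk + k)`, of dimension at most `c (4m + 1) ^ m (k + 1) ^
  -- m`, which is less than `r (k + 1) ^ m` for this `r`.
  obtain ⟨s, k, hs⟩ := key (c * (4 * m + 1) ^ m + 1)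
  have h1 := hs ⊤ (fun _ _ _ => ⟨trivial, trivial⟩) (fun _ _ => trivial) k le_rfl k
  rw [inf_top_eq] at h1
  have h2 : finrank K (W (4 * m * k + k)) ≤ c * (4 * m + 1) ^ m * (k + 1) ^ m := by
    refine (hc _).trans ?_
    rw [mul_assoc c, ← mul_pow]
    gcongr
    nlinarith
  have h3 : 0 < (k + 1) ^ m := by positivity
  nlinarith

end WeylAction

end WeylAction

/-! ### Finite generation of meromorphic connections over the Weyl algebra -/

section BoundedDegree

open MvPolynomial Module

variable {K σ ι M : Type*} [Field K] [Fintype ι] [AddCommGroup M] [Module K M]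
  [Module (MvPolynomial σ K) M] [IsScalarTower K (MvPolynomial σ K) M]

/-- The linear combinations of the `e i` with coefficients of total degree at most `j`. -/
noncomputable def boundedDegreeSpan (e : ι → M) (j : ℕ) : Submodule K M :=
  LinearMap.range (∑ i, (LinearMap.toSpanSingleton (MvPolynomial σ K) M (e i)).restrictScalars K ∘ₗ
    (restrictTotalDegree σ K j).subtype ∘ₗ LinearMap.proj i :
    (ι → restrictTotalDegree σ K j) →ₗ[K] M)

theorem mem_boundedDegreeSpan {e : ι → M} {j : ℕ} {m : M} :
    m ∈ boundedDegreeSpan (K := K) (σ := σ) e j ↔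
      ∃ p : ι → MvPolynomial σ K, (∀ i, (p i).totalDegree ≤ j) ∧ ∑ i, p i • e i = m := by
  constructor
  · rintro ⟨p, rfl⟩
    exact ⟨fun i => p i, fun i => (mem_restrictTotalDegree _ _ _).mp (p i).2, by simp⟩
  · rintro ⟨p, hp, rfl⟩
    exact ⟨fun i => ⟨p i, (mem_restrictTotalDegree _ _ _).mpr (hp i)⟩, by simp⟩

theorem boundedDegreeSpan_mono (e : ι → M) : Monotone (boundedDegreeSpan (K := K) (σ := σ) e) := by
  intro a b hab m hm
  rw [mem_boundedDegreeSpan] at hm ⊢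
  obtain ⟨p, hp, h⟩ := hm
  exact ⟨p, fun i => (hp i).trans hab, h⟩

theorem smul_mem_boundedDegreeSpan {e : ι → M} {a b : ℕ} {q : MvPolynomial σ K}
    (hq : q.totalDegree ≤ a) {m : M} (hm : m ∈ boundedDegreeSpan (K := K) (σ := σ) e b) :
    q • m ∈ boundedDegreeSpan (K := K) (σ := σ) e (a + b) := by
  rw [mem_boundedDegreeSpan] at hm ⊢
  obtain ⟨p, hp, rfl⟩ := hm
  exact ⟨fun i => q * p i, fun i => (totalDegree_mul _ _).trans (add_le_add hq (hp i)),
    by simp [Finset.smul_sum, mul_smul]⟩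

theorem exists_mem_boundedDegreeSpan {e : ι → M} {m : M}
    (hm : m ∈ Submodule.span (MvPolynomial σ K) (Set.range e)) :
    ∃ j, m ∈ boundedDegreeSpan (K := K) (σ := σ) e j := by
  obtain ⟨p, hp⟩ := (Submodule.mem_span_range_iff_exists_fun _).mp hm
  exact ⟨∑ i, (p i).totalDegree, mem_boundedDegreeSpan.mpr ⟨p, fun i =>
    Finset.single_le_sum (f := fun i => (p i).totalDegree) (fun _ _ => Nat.zero_le _)
      (Finset.mem_univ i), hp⟩⟩

variable [Fintype σ]

instance (e : ι → M) (j : ℕ) :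
    FiniteDimensional K (boundedDegreeSpan (K := K) (σ := σ) e j) := by
  unfold boundedDegreeSpan
  infer_instance

theorem finrank_boundedDegreeSpan_le (e : ι → M) (j : ℕ) :
    finrank K (boundedDegreeSpan (K := K) (σ := σ) e j) ≤
      Fintype.card ι * (j + 1) ^ Fintype.card σ := by
  refine (LinearMap.finrank_range_le _).trans ?_
  rw [Module.finrank_pi_fintype, Finset.sum_const, Finset.card_univ, smul_eq_mul,
    ← finrank_restrictDegree σ K]
  exact Nat.mul_le_mul_left _
    (Submodule.finrank_mono (restrictTotalDegree_le_restrictDegree (R := K) (σ := σ) j))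

end BoundedDegree

/-! ### The filtration by pole order and degree, and finite generation. -/

section Generation

open MvPolynomial Module

variable {σ ι M : Type*} [AddCommGroup M] [Module (MvPolynomial σ ℂ) M]

/-- Covariant derivation as a linear map over the constants. -/
def Connection.nablaLinear {κ R : Type*} [CommRing R] [Algebra ℂ R] {d : κ → Derivation ℂ R R}
    [Module R M] [Module ℂ M] [IsScalarTower ℂ R M] (D : Connection d M) (i : κ) :
    M →ₗ[ℂ] M :=
  { D.nabla i with
    map_smul' := fun c m => by
      have h := D.leibniz i (algebraMap ℂ R c) m
      rw [Derivation.map_algebraMap, zero_smul, zero_add, algebraMap_smul, algebraMap_smul] at h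
      exact h }

/-- The action of the coordinates and the covariant derivations. -/
noncomputable def Connection.weylAction [Module ℂ M] [IsScalarTower ℂ (MvPolynomial σ ℂ) M]
    (D : Connection (fun i : σ => MvPolynomial.pderiv (R := ℂ) i) M) (hD : D.IsIntegrable) :
    WeylAction ℂ σ M where
  z i := Algebra.lsmul ℂ ℂ M (X i : MvPolynomial σ ℂ)
  d i := D.nablaLinear i
  comm_z i j := (Commute.all _ _).map _
  comm_d i j := LinearMap.ext fun m => hD i j m
  comm_self i := LinearMap.ext fun m => by
    change D.nabla i ((X i : MvPolynomial σ ℂ) • m) - (X i : MvPolynomial σ ℂ) • D.nabla i m = m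
    rw [D.leibniz, pderiv_X_self, one_smul, add_sub_cancel_right]
  comm_ne i j h := LinearMap.ext fun m => by
    change D.nabla i ((X j : MvPolynomial σ ℂ) • m) = (X j : MvPolynomial σ ℂ) • D.nabla i m
    rw [D.leibniz, pderiv_X_of_ne h.symm, zero_smul, zero_add]

/-- Finitely many sections `∇_i e_u` have a common denominator, and the Leibniz rule then handles
all coefficients with a degree increase independent of `b`. The exponent is kept positive so that `f
^ (k + 1) ∂_i (f ^ N)` is divisible by `f ^ N`. -/
theorem Connection.exists_pow_smul_nabla_mem [Finite σ] [Fintype ι] [Module ℂ M]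
    [IsScalarTower ℂ (MvPolynomial σ ℂ) M]
    (D : Connection (fun i : σ => MvPolynomial.pderiv (R := ℂ) i) M)
    (f : MvPolynomial σ ℂ) (e : ι → M)
    (hs : ∀ m, ∃ k : ℕ, f ^ k • m ∈ Submodule.span (MvPolynomial σ ℂ) (Set.range e)) :
    ∃ k c : ℕ, ∀ i b, ∀ m ∈ boundedDegreeSpan (K := ℂ) (σ := σ) e b,
      f ^ (k + 1) • D.nabla i m ∈ boundedDegreeSpan (K := ℂ) (σ := σ) e (c + b) := by
  have := Fintype.ofFinite σ
  choose k hk using fun x : σ × ι => hs (D.nabla x.1 (e x.2))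
  set K := ∑ x, k x + 1 with hK
  have hK1 : ∀ x : σ × ι, f ^ K • D.nabla x.1 (e x.2) ∈
      Submodule.span (MvPolynomial σ ℂ) (Set.range e) := by
    intro x
    have hx : k x ≤ K := (Finset.single_le_sum (f := k) (fun _ _ => Nat.zero_le _)
      (Finset.mem_univ x)).trans (Nat.le_succ _)
    rw [← Nat.sub_add_cancel hx, pow_add, mul_smul]
    exact Submodule.smul_mem _ _ (hk x)
  choose j hj using fun x => exists_mem_boundedDegreeSpan (K := ℂ) (hK1 x)
  refine ⟨∑ x, k x, K * f.totalDegree + ∑ x, j x, fun i b m hm => ?_⟩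
  rw [← hK]
  obtain ⟨p, hp, rfl⟩ := mem_boundedDegreeSpan.mp hm
  rw [map_sum, Finset.smul_sum]
  refine Submodule.sum_mem _ fun u _ => ?_
  rw [D.leibniz, smul_add, smul_smul, smul_smul, mul_comm _ (p u), mul_smul (p u)]
  refine Submodule.add_mem _ ?_ ?_
  · refine boundedDegreeSpan_mono e (a := K * f.totalDegree + b) (by omega)
      (mem_boundedDegreeSpan.mpr ?_)
    classical
    refine ⟨Pi.single u (f ^ K * pderiv i (p u)), fun v => ?_, ?_⟩
    · by_cases hv : v = u
      · subst hv
        rw [Pi.single_eq_same]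
        refine (totalDegree_mul _ _).trans (add_le_add (totalDegree_pow _ _)
          (totalDegree_pderiv_le ((hp v).trans b.le_succ) i))
      · simp [Pi.single_eq_of_ne hv]
    · rw [Finset.sum_eq_single u]
      · simp
      · intro v _ hv
        simp [Pi.single_eq_of_ne hv]
      · simp
  · refine boundedDegreeSpan_mono e ?_ (smul_mem_boundedDegreeSpan (hp u) (hj (i, u)))
    have : j (i, u) ≤ ∑ x, j x :=
      Finset.single_le_sum (f := j) (fun _ _ => Nat.zero_le _) (Finset.mem_univ _)
    omega

/-- An integrable connection which is coherent over `𝒪[1/f]` is finitely generated as a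
`𝒟`-module. -/
theorem Connection.exists_finset_generates [Fintype σ] [Fintype ι]
    (D : Connection (fun i : σ => MvPolynomial.pderiv (R := ℂ) i) M) (hD : D.IsIntegrable)
    (f : MvPolynomial σ ℂ) (hf : ∀ m : M, f • m = 0 → m = 0) (e : ι → M)
    (hs : ∀ m, ∃ k : ℕ, f ^ k • m ∈ Submodule.span (MvPolynomial σ ℂ) (Set.range e)) :
    ∃ v : Finset M, D.Generates (v : Set M) := by
  let _ : Module ℂ M := Module.compHom M (algebraMap ℂ (MvPolynomial σ ℂ))
  have : IsScalarTower ℂ (MvPolynomial σ ℂ) M :=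
    ⟨fun c p m => by
      rw [Algebra.smul_def, mul_smul]
      rfl⟩
  obtain ⟨k, c, hk⟩ := D.exists_pow_smul_nabla_mem f e hs
  set a := (k + 1) * f.totalDegree with ha
  set B := a + c + 1 with hB
  set L := boundedDegreeSpan (K := ℂ) (σ := σ) e with hL
  have hfk : (f ^ (k + 1)).totalDegree ≤ a := totalDegree_pow _ _
  -- Elements of `W j` are fractions with denominator `f ^ ((k + 1) j)` and numerator of degree at
  -- most `B j`. The slope `B` covers the degree `a` of the extra denominator, the increase `c` due
  -- to `∇`, and `1` for a coordinate.
  let W : ℕ → Submodule ℂ M := fun j =>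
    (L (B * j)).comap (Algebra.lsmul ℂ ℂ M (f ^ ((k + 1) * j)))
  have hmem : ∀ j m, m ∈ W j ↔ f ^ ((k + 1) * j) • m ∈ L (B * j) := fun j m => Iff.rfl
  have hW : (D.weylAction hD).IsFiltration W := by
    refine ⟨monotone_nat_of_le_succ fun j m hm => ?_, fun i j m hm => ?_, fun i j m hm => ?_⟩
    · rw [hmem] at hm ⊢
      rw [mul_add (k + 1), mul_one, add_comm ((k + 1) * j), pow_add, mul_smul]
      exact boundedDegreeSpan_mono e (by nlinarith) (smul_mem_boundedDegreeSpan hfk hm)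
    · rw [hmem] at hm ⊢
      change _ • (X i : MvPolynomial σ ℂ) • m ∈ _
      rw [mul_add (k + 1), mul_one, add_comm ((k + 1) * j), pow_add, smul_smul, mul_right_comm, mul_smul]
      refine boundedDegreeSpan_mono e (a := (a + 1) + B * j) (by nlinarith)
        (smul_mem_boundedDegreeSpan ((totalDegree_mul _ _).trans ?_) hm)
      rw [totalDegree_X]
      omega
    · rw [hmem] at hm ⊢
      change _ • D.nabla i m ∈ _
      -- With `F = f ^ ((k + 1) j)`, the section `f ^ (k + 1) F ∇ m` is the difference of `f ^ (k +
      -- 1) ∇ (F m)` and `f ^ (k + 1) ∂(F) m`; the two terms raise the degree by at most `c` and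
      -- `a`.
      have h1 := hk i _ _ hm
      rw [D.leibniz, smul_add, smul_smul, smul_smul, ← pow_add] at h1
      have h2 : f ^ (k + 1) * pderiv i (f ^ ((k + 1) * j)) =
          (MvPolynomial.C (((k + 1) * j : ℕ) : ℂ) * (f ^ k * pderiv i f)) * f ^ ((k + 1) * j) := by
        generalize (k + 1) * j = N
        rcases N with _ | N
        · simp
        · rw [pderiv_pow, Nat.add_sub_cancel, map_natCast]
          ring
      have h3 : (f ^ (k + 1) * pderiv i (f ^ ((k + 1) * j))) • m ∈ L (a + B * j) := by
        rw [h2, mul_smul]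
        refine smul_mem_boundedDegreeSpan ?_ hm
        refine (totalDegree_mul _ _).trans ?_
        rw [totalDegree_C, zero_add]
        refine (totalDegree_mul _ _).trans ?_
        have h4 := totalDegree_pow f k
        have h5 := totalDegree_pderiv_le (f.totalDegree.le_succ) i
        rw [ha, add_mul, one_mul]
        exact add_le_add h4 h5
      rw [mul_add (k + 1), mul_one, add_comm ((k + 1) * j)]
      have h4 := Submodule.sub_mem _
        (boundedDegreeSpan_mono e (show c + B * j ≤ B * (j + 1) by nlinarith) h1)
        (boundedDegreeSpan_mono e (show a + B * j ≤ B * (j + 1) by nlinarith) h3)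
      rwa [add_sub_cancel_left] at h4
  have hinj : ∀ j, Function.Injective (Algebra.lsmul ℂ ℂ M (f ^ j)) := by
    intro j
    rw [injective_iff_map_eq_zero]
    induction j with
    | zero => simp
    | succ j ih =>
      intro m hm
      refine ih m (hf _ ?_)
      rw [Algebra.lsmul_coe] at hm ⊢
      rwa [smul_smul, ← pow_succ']
  let F : ∀ j, W j →ₗ[ℂ] L (B * j) := fun j =>
    (Algebra.lsmul ℂ ℂ M (f ^ ((k + 1) * j))).restrict fun m hm => hm
  have hF : ∀ j, Function.Injective (F j) := fun j m m' h =>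
    Subtype.ext (hinj _ (congrArg Subtype.val h))
  have hfin : ∀ j, FiniteDimensional ℂ (W j) := fun j => FiniteDimensional.of_injective (F j) (hF j)
  obtain ⟨s, hs'⟩ := hW.exists_finset_generates (c := Fintype.card ι * B ^ Fintype.card σ)
    (fun m => by
      obtain ⟨l, hl⟩ := hs m
      obtain ⟨b, hb⟩ := exists_mem_boundedDegreeSpan (K := ℂ) hl
      -- The step `l + b` admits both the denominator `f ^ l` and the numerator degree `b`; the
      -- unused powers of `f` cost at most `a (l + b)` in degree.
      refine ⟨l + b, ?_⟩
      rw [hmem]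
      have h1 : (k + 1) * (l + b) = ((k + 1) * (l + b) - l) + l :=
        (Nat.sub_add_cancel (by nlinarith)).symm
      rw [h1, pow_add, mul_smul]
      refine boundedDegreeSpan_mono e ?_ (smul_mem_boundedDegreeSpan (totalDegree_pow _ _) hb)
      have h2 : ((k + 1) * (l + b) - l) * f.totalDegree ≤ (k + 1) * (l + b) * f.totalDegree :=
        Nat.mul_le_mul_right _ (Nat.sub_le _ _)
      have h3 : (k + 1) * (l + b) * f.totalDegree = a * (l + b) := by rw [ha]; ring
      nlinarith)
    (fun j => by
      refine (LinearMap.finrank_le_finrank_of_injective (hF j)).trans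
        ((finrank_boundedDegreeSpan_le e _).trans ?_)
      rw [mul_assoc (Fintype.card ι), ← mul_pow]
      gcongr
      nlinarith)
  refine ⟨s, fun N hsN hN => ?_⟩
  have := hs' (N.restrictScalars ℂ) (fun i m hm => ⟨N.smul_mem _ hm, hN i m hm⟩) hsN
  exact (Submodule.restrictScalars_eq_top_iff ℂ _ _).mp this

end Generation

/-! ### Integrability and generation of inverse images -/

section Functoriality

variable {ι κ R S : Type*} [CommRing R] [Algebra ℂ R] [CommRing S] [Algebra ℂ S]
  {d : ι → Derivation ℂ R R}

theorem Connection.IsIntegrable.hom {M N : Type*} [AddCommGroup M] [Module R M]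
    [AddCommGroup N] [Module R N] {D : Connection d M} {D' : Connection d N}
    (hD : D.IsIntegrable) (hD' : D'.IsIntegrable) : (D.hom D').IsIntegrable := by
  intro i j u
  ext m
  change D'.nabla i (D'.nabla j (u m) - u (D.nabla j m)) -
      (D'.nabla j (u (D.nabla i m)) - u (D.nabla j (D.nabla i m))) =
    D'.nabla j (D'.nabla i (u m) - u (D.nabla i m)) -
      (D'.nabla i (u (D.nabla j m)) - u (D.nabla i (D.nabla j m)))
  rw [map_sub, map_sub, hD i j, hD' i j]
  abel

theorem Connection.IsIntegrable.directImage {θ : ι → Derivation ℂ S S} {N : Type*}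
    [AddCommGroup N] [Module S N] {D : Connection θ N} (hD : D.IsIntegrable) (φ : R →ₐ[ℂ] S)
    (h : ∀ i r, θ i (φ r) = φ (d i r)) : (D.directImage φ h).IsIntegrable :=
  hD

/-- Write `q s = r` with `q` a power of `f`. Differentiating this relation twice, in either order,
determines `q` times the second derivatives of `s`, and `q` is a unit. -/
theorem awayDerivation_comm (f : R) {d₁ d₂ : Derivation ℂ R R} (h : ∀ r, d₁ (d₂ r) = d₂ (d₁ r))
    (s : Localization.Away f) : awayDerivation f d₁ (awayDerivation f d₂ s) =
      awayDerivation f d₂ (awayDerivation f d₁ s) := by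
  obtain ⟨k, r, hr⟩ := IsLocalization.Away.surj f s
  have hu : IsUnit (algebraMap R (Localization.Away f) f ^ k) :=
    (IsLocalization.Away.algebraMap_isUnit f).pow k
  rw [← map_pow] at hr hu
  set q := f ^ k
  have h0 : ∀ d : Derivation ℂ R R, algebraMap R (Localization.Away f) q * awayDerivation f d s =
      algebraMap R _ (d r) - s * algebraMap R _ (d q) := by
    intro d
    have := congrArg (awayDerivation f d) hr
    rw [Derivation.leibniz, awayDerivation_algebraMap, awayDerivation_algebraMap, smul_eq_mul,
      smul_eq_mul] at this
    rw [← this]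
    ring
  have h1 := congrArg (awayDerivation f d₁) (h0 d₂)
  have h2 := congrArg (awayDerivation f d₂) (h0 d₁)
  simp only [Derivation.leibniz, map_sub, awayDerivation_algebraMap, smul_eq_mul] at h1 h2
  refine hu.mul_left_cancel ?_
  rw [h r, h q] at h1
  linear_combination h1 - h2

theorem Connection.Generates.mono_span {M : Type*} [AddCommGroup M] [Module R M]
    {D : Connection d M} {s t : Set M} (hs : D.Generates s) (h : s ⊆ Submodule.span R t) :
    D.Generates t := fun N hN hst =>
  hs N (h.trans (Submodule.span_le.mpr hN)) hst

variable [Fintype ι] {θ : κ → Derivation ℂ S S} {M : Type*} [AddCommGroup M] [Module R M]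

theorem Connection.inverseImage_nabla_tmul (D : Connection d M) (f : DiffMap d θ) (k : κ) (s : S)
    (m : M) : (D.inverseImage f).nabla k (InverseImage.tmul f.toAlgHom s m) =
      InverseImage.tmul f.toAlgHom (θ k s) m +
        ∑ i, InverseImage.tmul f.toAlgHom (s * f.jac k i) (D.nabla i m) :=
  rfl

theorem InverseImage.tmul_sum (φ : R →ₐ[ℂ] S) {α : Type*} (t : Finset α) (s : S) (m : α → M) :
    tmul φ s (∑ i ∈ t, m i) = ∑ i ∈ t, tmul φ s (m i) := by
  simp only [← tmulHom_apply, map_sum]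

theorem InverseImage.tmul_zero (φ : R →ₐ[ℂ] S) (s : S) : tmul φ s (0 : M) = 0 := by
  rw [← tmulHom_apply, map_zero]

theorem InverseImage.smul_tmul_one (φ : R →ₐ[ℂ] S) (r : R) (m : M) :
    φ r • tmul φ 1 m = tmul φ 1 (r • m) := by
  rw [smul_tmul, tmul_smul]

theorem InverseImage.eq_smul_tmul_one (φ : R →ₐ[ℂ] S) (s : S) (m : M) :
    tmul φ s m = s • tmul φ 1 m := by
  rw [smul_tmul, mul_one]

/-- The map `m ↦ 1 ⊗ m` carries a span into the span of the image. -/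
theorem InverseImage.tmul_mem_span (φ : R →ₐ[ℂ] S) {t : Set M} {m : M}
    (hm : m ∈ Submodule.span R t) (s : S) : tmul φ s m ∈ Submodule.span S (tmul φ 1 '' t) := by
  rw [eq_smul_tmul_one]
  refine Submodule.smul_mem _ _ ?_
  induction hm using Submodule.span_induction with
  | mem x hx => exact Submodule.subset_span ⟨x, hx, rfl⟩
  | zero => rw [tmul_zero]; exact Submodule.zero_mem _
  | add x y _ _ hx hy => rw [tmul_add]; exact Submodule.add_mem _ hx hy
  | smul r x _ hx => rw [← smul_tmul_one]; exact Submodule.smul_mem _ _ hx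

/-- In the double derivative of `s ⊗ m`, the terms with one `∇_i` are symmetric because the rows of
the Jacobian satisfy the closedness condition `hf`, and those with two because the `∇_i` commute. -/
theorem Connection.IsIntegrable.inverseImage {D : Connection d M} (hD : D.IsIntegrable)
    (f : DiffMap d θ) (hθ : ∀ k l s, θ k (θ l s) = θ l (θ k s))
    (hf : ∀ k l i, θ k (f.jac l i) = θ l (f.jac k i)) : (D.inverseImage f).IsIntegrable := by
  have key : ∀ k l s m, (D.inverseImage f).nabla k ((D.inverseImage f).nabla l
      (InverseImage.tmul f.toAlgHom s m)) =
      InverseImage.tmul f.toAlgHom (θ k (θ l s)) m +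
      (∑ i, InverseImage.tmul f.toAlgHom (θ l s * f.jac k i) (D.nabla i m) +
        ∑ i, InverseImage.tmul f.toAlgHom (θ k s * f.jac l i) (D.nabla i m)) +
      ∑ i, InverseImage.tmul f.toAlgHom (s * θ k (f.jac l i)) (D.nabla i m) +
      ∑ i, ∑ j, InverseImage.tmul f.toAlgHom (s * f.jac l i * f.jac k j)
        (D.nabla j (D.nabla i m)) := by
    intro k l s m
    simp only [D.inverseImage_nabla_tmul, map_add, map_sum, Derivation.leibniz, smul_eq_mul,
      InverseImage.add_tmul, Finset.sum_add_distrib]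
    simp only [mul_comm (f.jac l _) (θ k s)]
    abel
  intro k l z
  induction z using InverseImage.induction with
  | h0 => simp
  | ha x y hx hy => simp only [map_add, hx, hy]
  | ht s m =>
    rw [key, key, hθ k l s]
    simp only [hf k l]
    congr 1
    · abel
    · rw [Finset.sum_comm]
      refine Finset.sum_congr rfl fun i _ => Finset.sum_congr rfl fun j _ => ?_
      rw [hD i j, mul_right_comm]

variable [DecidableEq ι] {θ : ι → Derivation ℂ S S}

theorem Connection.inverseImage_nabla_tmul_of_jac (D : Connection d M) {f : DiffMap d θ}
    (hf : ∀ k i, f.jac k i = if k = i then 1 else 0) (k : ι) (s : S) (m : M) :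
    (D.inverseImage f).nabla k (InverseImage.tmul f.toAlgHom s m) =
      InverseImage.tmul f.toAlgHom (θ k s) m + InverseImage.tmul f.toAlgHom s (D.nabla k m) := by
  rw [D.inverseImage_nabla_tmul, Finset.sum_eq_single k]
  · rw [hf, if_pos rfl, mul_one]
  · intro i _ hi
    rw [hf, if_neg hi.symm, mul_zero, ← InverseImage.tmulHom_apply, map_zero]
    rfl
  · simp

theorem Connection.inverseImage_nabla_one_tmul (D : Connection d M) {f : DiffMap d θ}
    (hf : ∀ k i, f.jac k i = if k = i then 1 else 0) (k : ι) (m : M) :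
    (D.inverseImage f).nabla k (InverseImage.tmul f.toAlgHom 1 m) =
      InverseImage.tmul f.toAlgHom 1 (D.nabla k m) := by
  rw [D.inverseImage_nabla_tmul_of_jac hf, Derivation.map_one_eq_zero,
    ← InverseImage.tmulHom_apply, map_zero, AddMonoidHom.zero_apply, zero_add]

theorem Connection.Generates.inverseImage {D : Connection d M} {s : Set M} (hs : D.Generates s)
    {f : DiffMap d θ} (hf : ∀ k i, f.jac k i = if k = i then 1 else 0) :
    (D.inverseImage f).Generates (InverseImage.tmul f.toAlgHom 1 '' s) := by
  intro N hN hst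
  let N' : Submodule R M :=
    { carrier := {m | InverseImage.tmul f.toAlgHom 1 m ∈ N}
      add_mem' := fun {a b} ha hb => by
        simp only [Set.mem_ofPred_eq, InverseImage.tmul_add] at *
        exact N.add_mem ha hb
      zero_mem' := by
        simp only [Set.mem_ofPred_eq, InverseImage.tmul_zero, N.zero_mem]
      smul_mem' := fun r m hm => by
        simp only [Set.mem_ofPred_eq, ← InverseImage.smul_tmul_one] at *
        exact N.smul_mem _ hm }
  have h : N' = ⊤ := hs N' (fun m hm => hN ⟨m, hm, rfl⟩) fun i m hm => by
    have := hst i _ hm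
    rwa [D.inverseImage_nabla_one_tmul hf] at this
  refine eq_top_iff.mpr fun z _ => ?_
  induction z using InverseImage.induction with
  | h0 => exact N.zero_mem
  | ha x y hx hy => exact N.add_mem (hx trivial) (hy trivial)
  | ht s m =>
    rw [InverseImage.eq_smul_tmul_one]
    exact N.smul_mem _ (show m ∈ N' from h ▸ trivial)

end Functoriality

/-! ### A criterion for property `L` -/

section PropertyL

variable {n l : ℕ}

theorem coeffDerivation_C {R : Type*} [CommRing R] [Algebra ℂ R] (d : Derivation ℂ R R) (r : R) :
    coeffDerivation l d (MvPolynomial.C r) = MvPolynomial.C (d r) := by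
  classical
  ext μ
  change MvPolynomial.coeff μ (coeffDerivationFun l d _) = _
  rw [coeff_coeffDerivationFun, MvPolynomial.coeff_C, MvPolynomial.coeff_C]
  split_ifs <;> simp

theorem coeffDerivation_X {R : Type*} [CommRing R] [Algebra ℂ R] (d : Derivation ℂ R R)
    (i : Fin l) : coeffDerivation l d (MvPolynomial.X i) = 0 := by
  classical
  ext μ
  change MvPolynomial.coeff μ (coeffDerivationFun l d _) = _
  rw [coeff_coeffDerivationFun, MvPolynomial.coeff_X]
  split_ifs <;> simp

/-- Coordinates centred at `x` differ from the given ones by constants, so the coordinate vector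
fields correspond. -/
theorem completionMap_jac (x : Fin n → ℂ) (k i : Fin n ⊕ Fin l) :
    (completionMap n l x).jac k i = if k = i then 1 else 0 := by
  change formalDerivation n l k (Sum.elim _ _ i) = _
  rcases k with k | k <;> rcases i with i | i
  · simp only [formalDerivation, Sum.elim_inl, coeffDerivation_C, map_add,
      MvPowerSeries.pderiv_C, MvPowerSeries.pderiv_X, Sum.inl.injEq, Pi.single_apply]
    simp [eq_comm]
  · simp [formalDerivation, coeffDerivation_X]
  · simp [formalDerivation]
  · simp [formalDerivation, MvPolynomial.pderiv_X, Pi.single_apply, eq_comm]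

/-- The functions on the bundle whose expansion at `x` has coefficients of small degree. -/
def smallDegreeSubalgebra (n l : ℕ) : Subalgebra ℂ (FormalBundleRing n l) where
  carrier := {g | HasSmallDegree g}
  add_mem' := fun {g q} hg hq ν μ h => by
    rw [MvPolynomial.coeff_add, map_add] at h
    by_cases h0 : MvPowerSeries.coeff ν (MvPolynomial.coeff μ g) = 0
    · rw [h0, zero_add] at h
      exact hq ν μ h
    · exact hg ν μ h0
  mul_mem' := fun {g q} hg hq ν μ h => by
    classical
    rw [MvPolynomial.coeff_mul, map_sum] at h
    obtain ⟨p, hp, h⟩ := Finset.exists_ne_zero_of_sum_ne_zero h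
    rw [MvPowerSeries.coeff_mul] at h
    obtain ⟨r, hr, h⟩ := Finset.exists_ne_zero_of_sum_ne_zero h
    rw [← Finset.HasAntidiagonal.mem_antidiagonal.mp hp, ← Finset.HasAntidiagonal.mem_antidiagonal.mp hr, map_add, map_add]
    exact add_le_add (hg _ _ (left_ne_zero_of_mul h)) (hq _ _ (right_ne_zero_of_mul h))
  algebraMap_mem' := fun c ν μ h => by
    classical
    rw [MvPolynomial.algebraMap_apply, MvPolynomial.coeff_C] at h
    split_ifs at h with h0
    · rw [← h0]
      simp
    · simp at h

theorem C_mem_smallDegreeSubalgebra (r : MvPowerSeries (Fin n) ℂ) :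
    MvPolynomial.C r ∈ smallDegreeSubalgebra n l := by
  classical
  intro ν μ h
  rw [MvPolynomial.coeff_C] at h
  split_ifs at h with h0
  · rw [← h0]
    simp
  · simp at h

theorem X_pow_mul_X_mem_smallDegreeSubalgebra {k : ℕ} (hk : 1 ≤ k) (i : Fin n) (j : Fin l) :
    MvPolynomial.C (MvPowerSeries.X i) ^ k * MvPolynomial.X j ∈ smallDegreeSubalgebra n l := by
  classical
  intro ν μ h
  rw [← map_pow, MvPolynomial.coeff_C_mul, MvPolynomial.coeff_X] at h
  split_ifs at h with h0
  · rw [mul_one, MvPowerSeries.coeff_X_pow] at h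
    rw [← h0, Finsupp.degree_single]
    split_ifs at h with h1
    · rw [h1, Finsupp.degree_single]
      exact hk
    · exact absurd rfl h
  · simp at h

/-- The neighbourhood is the locus where the image of `g` does not vanish. There the `e j` span `s`,
hence generate, and the connection matrix has entries `c / g ^ k` with `c ∈ A`. Only the
`y`-derivatives need to be controlled. -/
theorem Connection.propertyLAt_of_generators {M : Type*} [AddCommGroup M]
    [Module (BundleRing n l) M]
    (D : Connection (fun i : Fin n ⊕ Fin l => MvPolynomial.pderiv (R := ℂ) i) M)
    (x : Fin n → ℂ) (g : BundleRing n l)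
    (hg : IsUnit (MvPolynomial.map (MvPowerSeries.constantCoeff (σ := Fin n) (R := ℂ))
      ((completionMap n l x).toAlgHom g)))
    {A : Subalgebra ℂ (BundleRing n l)}
    (hA : ∀ r ∈ A, HasSmallDegree ((completionMap n l x).toAlgHom r)) (hgA : g ∈ A)
    {s : Set M} (hs : D.Generates s) {m : ℕ} (e : Fin m → M)
    (hse : ∀ v ∈ s, ∃ k : ℕ, g ^ k • v ∈ Submodule.span (BundleRing n l) (Set.range e))
    (k : ℕ) (he : ∀ i j, g ^ k • D.nabla (Sum.inr i) (e j) ∈ Submodule.span A (Set.range e)) :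
    D.PropertyLAt x := by
  set φ := (completionMap n l x).toAlgHom with hφ
  set h := φ g with hh
  set ψ := (DiffMap.away (formalDerivation n l) h).toAlgHom with hψ
  have hψ1 : IsUnit (ψ h) := IsLocalization.Away.algebraMap_isUnit h
  obtain ⟨w, hw⟩ := hψ1
  have hjac := completionMap_jac (n := n) (l := l) x
  have hjac' : ∀ k i, (DiffMap.away (formalDerivation n l) h).jac k i = if k = i then 1 else 0 :=
    fun k i => rfl
  let E : M → InverseImage ψ (InverseImage φ M) := fun v =>
    InverseImage.tmul ψ 1 (InverseImage.tmul φ 1 v)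
  have hE : ∀ (r : BundleRing n l) (v : M), E (r • v) = ψ (φ r) • E v := fun r v => by
    simp only [E, ← InverseImage.smul_tmul_one]
  have hEsum : ∀ (v : Fin m → M), E (∑ u, v u) = ∑ u, E (v u) := fun v => by
    simp only [E, InverseImage.tmul_sum]
  refine ⟨h, hg, m, fun j => E (e j), ?_, ?_⟩
  · refine ((hs.inverseImage hjac).inverseImage hjac').mono_span ?_
    rintro _ ⟨_, ⟨v, hv, rfl⟩, rfl⟩
    obtain ⟨k, hk⟩ := hse v hv
    have h1 := InverseImage.tmul_mem_span ψ (InverseImage.tmul_mem_span φ hk 1) 1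
    rw [← InverseImage.smul_tmul_one, ← InverseImage.smul_tmul_one] at h1
    have h2 := Submodule.smul_mem _ ((↑(w⁻¹ ^ k) : Localization.Away h)) h1
    rw [smul_smul, map_pow, ← hh, map_pow, ← hw, ← Units.val_pow_eq_pow_val, ← Units.val_mul,
      inv_pow, inv_mul_cancel, Units.val_one, one_smul, ← Set.range_comp, ← Set.range_comp] at h2
    exact h2
  · choose c hc using fun i j => (Submodule.mem_span_range_iff_exists_fun A).mp (he i j)
    refine ⟨fun i j u => (↑(w⁻¹ ^ k) : Localization.Away h) * ψ (φ (c i j u)), ?_, ?_⟩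
    · intro i j u
      refine ⟨φ (c i j u), h ^ k, hA _ (c i j u).2, ?_, ?_, ?_⟩
      · rw [hh, ← map_pow]
        exact hA _ (A.pow_mem hgA k)
      · rw [map_pow]
        exact (IsLocalization.Away.algebraMap_isUnit h).pow k
      · change _ * ψ (φ _) * ψ (h ^ k) = ψ (φ _)
        rw [map_pow, ← hw, mul_right_comm, ← Units.val_pow_eq_pow_val, ← Units.val_mul,
          inv_pow, inv_mul_cancel, Units.val_one, one_mul]
    · intro i j
      have h1 : ((D.inverseImage (completionMap n l x)).inverseImage
          (DiffMap.away (formalDerivation n l) h)).nabla (Sum.inr i) (E (e j)) =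
          E (D.nabla (Sum.inr i) (e j)) :=
        (Connection.inverseImage_nabla_one_tmul _ hjac' _ _).trans
          (congrArg (InverseImage.tmul ψ 1) (D.inverseImage_nabla_one_tmul hjac _ _))
      have h2 := congrArg E (hc i j)
      rw [hEsum, hE, map_pow, map_pow, ← hh, ← hw] at h2
      refine h1.trans ?_
      simp only [mul_smul]
      rw [← Finset.smul_sum]
      have h3 : ∑ u, ψ (φ (c i j u)) • E (e u) = ∑ u, E (c i j u • e u) :=
        Finset.sum_congr rfl fun u _ => (hE _ _).symm
      rw [h3, h2, smul_smul, ← Units.val_pow_eq_pow_val, ← Units.val_mul, inv_pow,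
        inv_mul_cancel, Units.val_one, one_smul]

end PropertyL

/-! ### Lattices of bounded pole order -/

section LocalGenerators

variable {R M : Type*} [CommRing R] [Algebra ℂ R] [AddCommGroup M] [Module R M]

/-- The inclusion of the open subset `f ≠ 0`, on functions. -/
noncomputable abbrev awayHom (f : R) : R →ₐ[ℂ] Localization.Away f :=
  IsScalarTower.toAlgHom ℂ R (Localization.Away f)

theorem InverseImage.exists_pow_smul_eq_tmul (f : R) (z : InverseImage (awayHom f) M) :
    ∃ (k : ℕ) (m : M), awayHom f f ^ k • z = tmul (awayHom f) 1 m := by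
  induction z using InverseImage.induction with
  | h0 => exact ⟨0, 0, by rw [smul_zero, tmul_zero]⟩
  | ha x y hx hy =>
    obtain ⟨k, m, hm⟩ := hx
    obtain ⟨k', m', hm'⟩ := hy
    refine ⟨k + k', f ^ k' • m + f ^ k • m', ?_⟩
    rw [tmul_add, ← smul_tmul_one, ← smul_tmul_one, ← hm, ← hm', smul_add, smul_smul, smul_smul,
      map_pow, map_pow, ← pow_add, ← pow_add, add_comm k']
  | ht s m =>
    obtain ⟨k, r, hr⟩ := IsLocalization.Away.surj f s
    refine ⟨k, r • m, ?_⟩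
    rw [smul_tmul, tmul_smul, mul_one, mul_comm]
    exact congrArg (fun t => tmul (awayHom f) t m) hr

/-- The inverse image maps to the localized module `M_f`, and the kernel of `M → M_f` is the
`f`-power torsion. -/
theorem InverseImage.exists_pow_smul_eq_zero (f : R) {m : M}
    (hm : tmul (awayHom f) 1 m = 0) : ∃ k : ℕ, f ^ k • m = 0 := by
  let F : Localization.Away f →+ M →+ LocalizedModule (Submonoid.powers f) M :=
    AddMonoidHom.mk' (fun s => AddMonoidHom.mk'
      (fun m => s • LocalizedModule.mkLinearMap (Submonoid.powers f) M m)
      (fun m m' => by rw [map_add, smul_add]))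
      (fun s s' => AddMonoidHom.ext fun m => add_smul _ _ _)
  have h := congrArg (lift (awayHom f) F (fun r s m => by
    change (awayHom f r * s) • LocalizedModule.mkLinearMap (Submonoid.powers f) M m =
      s • LocalizedModule.mkLinearMap (Submonoid.powers f) M (r • m)
    rw [map_smul, mul_comm, mul_smul]
    congr 1
    exact algebraMap_smul _ _ _)) hm
  rw [lift_tmul, map_zero] at h
  change (1 : Localization.Away f) • LocalizedModule.mkLinearMap (Submonoid.powers f) M m = 0 at h
  rw [one_smul, IsLocalizedModule.eq_zero_iff (Submonoid.powers f)] at h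
  obtain ⟨⟨_, k, rfl⟩, hk⟩ := h
  exact ⟨k, hk⟩

theorem InverseImage.exists_pow_smul_mem_span (f : R) {t : Set M} {m : M}
    (hm : tmul (awayHom f) 1 m ∈ Submodule.span (Localization.Away f) (tmul (awayHom f) 1 '' t)) :
    ∃ k : ℕ, f ^ k • m ∈ Submodule.span R t := by
  have key : ∀ z ∈ Submodule.span (Localization.Away f) (tmul (awayHom f) 1 '' t),
      ∃ k : ℕ, ∃ m' ∈ Submodule.span R t, awayHom f f ^ k • z = tmul (awayHom f) 1 m' := by
    intro z hz
    induction hz using Submodule.span_induction with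
    | mem x hx =>
      obtain ⟨m, hm, rfl⟩ := hx
      exact ⟨0, m, Submodule.subset_span hm, by rw [pow_zero, one_smul]⟩
    | zero => exact ⟨0, 0, Submodule.zero_mem _, by rw [smul_zero, tmul_zero]⟩
    | add x y _ _ hx hy =>
      obtain ⟨k, m, h, hm⟩ := hx
      obtain ⟨k', m', h', hm'⟩ := hy
      refine ⟨k + k', f ^ k' • m + f ^ k • m', Submodule.add_mem _ (Submodule.smul_mem _ _ h)
        (Submodule.smul_mem _ _ h'), ?_⟩
      rw [tmul_add, ← smul_tmul_one, ← smul_tmul_one, ← hm, ← hm', smul_add, smul_smul, smul_smul,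
        map_pow, map_pow, ← pow_add, ← pow_add, add_comm k']
    | smul s x _ hx =>
      obtain ⟨k, m, h, hm⟩ := hx
      obtain ⟨l, r, hr⟩ := IsLocalization.Away.surj f s
      refine ⟨l + k, r • m, Submodule.smul_mem _ _ h, ?_⟩
      rw [← smul_tmul_one, ← hm, smul_smul, smul_smul, pow_add, mul_right_comm,
        mul_comm (awayHom f f ^ l)]
      exact congrArg (fun t => (t * awayHom f f ^ k) • x) hr
  obtain ⟨k, m', h, hm'⟩ := key _ hm
  have h0 : tmul (awayHom f) 1 (f ^ k • m - m') = 0 := by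
    rw [← tmulHom_apply, map_sub, tmulHom_apply, tmulHom_apply, ← smul_tmul_one, map_pow, hm',
      sub_self]
  obtain ⟨l, hl⟩ := exists_pow_smul_eq_zero f h0
  refine ⟨l + k, ?_⟩
  rw [smul_sub, sub_eq_zero, smul_smul, ← pow_add] at hl
  rw [hl]
  exact Submodule.smul_mem _ _ h

end LocalGenerators

/-! ### Global sections spanning a lattice of bounded pole order. -/

section BoundedLattice

variable {n : ℕ} {M : Type*} [AddCommGroup M] [Module (AffineRing (n + 1)) M]
  {D : Connection (fun i : Fin (n + 1) => MvPolynomial.pderiv (R := ℂ) i) M}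

/-- If a `𝒟`-module is generated by a submodule with the poles of `c ^ (ρ i) ∂_i` bounded, then
every section is carried into the submodule by a power of `c`. -/
theorem Connection.Generates.exists_pow_smul_mem {ι R M : Type*} [CommRing R] [Algebra ℂ R]
    {d : ι → Derivation ℂ R R} [AddCommGroup M] [Module R M] {D : Connection d M}
    {N : Submodule R M} (hN : D.Generates (N : Set M)) (c : R) (p : ι → ℕ)
    (h : ∀ i, ∀ m ∈ N, c ^ p i • D.nabla i m ∈ N) (m : M) : ∃ k : ℕ, c ^ k • m ∈ N := by
  let N' : Submodule R M :=
    { carrier := {m | ∃ k : ℕ, c ^ k • m ∈ N}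
      add_mem' := by
        rintro m m' ⟨k, hk⟩ ⟨k', hk'⟩
        refine ⟨k + k', ?_⟩
        rw [smul_add]
        refine N.add_mem ?_ ?_
        · rw [add_comm, pow_add, mul_smul]
          exact N.smul_mem _ hk
        · rw [pow_add, mul_smul]
          exact N.smul_mem _ hk'
      zero_mem' := ⟨0, by rw [smul_zero]; exact N.zero_mem⟩
      smul_mem' := by
        rintro r m ⟨k, hk⟩
        exact ⟨k, by rw [smul_comm]; exact N.smul_mem _ hk⟩ }
  have hN' : N' = ⊤ := by
    refine hN N' (fun m hm => ⟨0, by rwa [pow_zero, one_smul]⟩) ?_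
    rintro i m ⟨k, hk⟩
    -- The factor `c ^ (p i)` makes `∇_i (c ^ k m)` land in `N`; the additional factor `c` makes the
    -- Leibniz term `d_i(c ^ k) m` a multiple of `c ^ k m`.
    refine ⟨p i + 1 + k, ?_⟩
    have h1 := N.smul_mem c (h i _ hk)
    rw [D.leibniz, smul_add, smul_add, Derivation.leibniz_pow] at h1
    have h2 : c • c ^ p i • ((k • c ^ (k - 1) • d i c : R) • m) ∈ N := by
      have h3 : c * c ^ p i * (k • c ^ (k - 1) • d i c : R) = (k * c ^ p i * d i c) * c ^ k := by
        rcases k with _ | k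
        · simp
        · rw [Nat.add_sub_cancel, nsmul_eq_mul, smul_eq_mul]
          ring
      rw [smul_smul, smul_smul, h3, mul_smul]
      exact N.smul_mem _ hk
    have h4 := N.sub_mem h1 h2
    rwa [add_sub_cancel_left, smul_smul, smul_smul, ← pow_succ', ← pow_add] at h4
  exact show m ∈ N' from hN' ▸ trivial

/-- A lattice with bounded poles on the open subset `f ≠ 0` is spanned by global sections, up to
powers of `f`. -/
theorem Connection.exists_generators_of_away {ι R M : Type*} [Fintype ι] [CommRing R] [Algebra ℂ R]
    {d : ι → Derivation ℂ R R} [AddCommGroup M] [Module R M] (D : Connection d M) (f c : R)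
    (p : ι → ℕ) {θ : ι → Derivation ℂ (Localization.Away f) (Localization.Away f)}
    (D' : Connection θ (InverseImage (awayHom f) M))
    (hD' : ∀ i m, D'.nabla i (InverseImage.tmul (awayHom f) 1 m) =
      InverseImage.tmul (awayHom f) 1 (D.nabla i m))
    {N : Submodule (Localization.Away f) (InverseImage (awayHom f) M)} (hfg : N.FG)
    (hgen : D'.Generates (N : Set _)) (hst : ∀ i, ∀ m ∈ N, awayHom f (c ^ p i) • D'.nabla i m ∈ N) :
    ∃ (r : ℕ) (v : Fin r → M),
      (∃ k : ℕ, ∀ i j, (f ^ k * c ^ p i) • D.nabla i (v j) ∈ Submodule.span R (Set.range v)) ∧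
      ∀ m, ∃ k : ℕ, (f * c) ^ k • m ∈ Submodule.span R (Set.range v) := by
  obtain ⟨r, z, hz⟩ := Submodule.fg_iff_exists_fin_generating_family.mp hfg
  choose k v hv using fun j => InverseImage.exists_pow_smul_eq_tmul f (z j)
  have hu : IsUnit (awayHom f f) := IsLocalization.Away.algebraMap_isUnit f
  have hspan : Submodule.span (Localization.Away f)
      (InverseImage.tmul (awayHom f) 1 '' Set.range v) = N := by
    rw [← hz, ← Set.range_comp]
    refine le_antisymm (Submodule.span_le.mpr ?_) (Submodule.span_le.mpr ?_)
    · rintro _ ⟨j, rfl⟩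
      rw [Function.comp_apply, ← hv]
      exact Submodule.smul_mem _ _ (Submodule.subset_span ⟨j, rfl⟩)
    · rintro _ ⟨j, rfl⟩
      obtain ⟨w, hw⟩ := hu.pow (k j)
      have h1 : z j = (↑w⁻¹ : Localization.Away f) • InverseImage.tmul (awayHom f) 1 (v j) := by
        rw [← hv, ← hw, smul_smul, Units.inv_mul, one_smul]
      rw [h1]
      exact Submodule.smul_mem _ _ (Submodule.subset_span ⟨j, rfl⟩)
  refine ⟨r, v, ?_, fun m => ?_⟩
  · have h1 : ∀ q : ι × Fin r, ∃ l : ℕ, f ^ l • (c ^ p q.1 • D.nabla q.1 (v q.2)) ∈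
        Submodule.span R (Set.range v) := by
      rintro ⟨i, j⟩
      refine InverseImage.exists_pow_smul_mem_span f ?_
      rw [hspan, ← InverseImage.smul_tmul_one, ← hD']
      exact hst i _ (hspan ▸ Submodule.subset_span ⟨v j, ⟨j, rfl⟩, rfl⟩)
    choose l hl using h1
    refine ⟨∑ q, l q, fun i j => ?_⟩
    rw [mul_smul, ← Nat.sub_add_cancel (Finset.single_le_sum (f := l) (fun _ _ => Nat.zero_le _)
      (Finset.mem_univ (i, j))), pow_add, mul_smul]
    exact Submodule.smul_mem _ _ (hl (i, j))
  · obtain ⟨a, ha⟩ := hgen.exists_pow_smul_mem (awayHom f c) p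
      (fun i m hm => by
        have := hst i m hm
        rwa [map_pow] at this)
      (InverseImage.tmul (awayHom f) 1 m)
    rw [← map_pow, InverseImage.smul_tmul_one, ← hspan] at ha
    obtain ⟨b, hb⟩ := InverseImage.exists_pow_smul_mem_span f ha
    refine ⟨a + b, ?_⟩
    have h2 : (f * c) ^ (a + b) = (f ^ a * c ^ b) * (f ^ b * c ^ a) := by ring
    rw [h2, mul_smul, mul_smul (f ^ b)]
    exact Submodule.smul_mem _ _ hb

theorem Connection.IsLocallyGeneratedBounded.exists_generators {ρ : ℕ}
    (hD : D.IsLocallyGeneratedBounded ρ) (x : Fin (n + 1) → ℂ) :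
    ∃ f : AffineRing (n + 1), MvPolynomial.eval x f ≠ 0 ∧ ∃ (r : ℕ) (v : Fin r → M),
      (∃ k : ℕ, ∀ i j, (f ^ k * MvPolynomial.X (Fin.last n) ^ poleExponent ρ i) •
        D.nabla i (v j) ∈ Submodule.span (AffineRing (n + 1)) (Set.range v)) ∧
      ∀ m, ∃ k : ℕ, (f * MvPolynomial.X (Fin.last n)) ^ k • m ∈
        Submodule.span (AffineRing (n + 1)) (Set.range v) := by
  obtain ⟨f, hf, N, hfg, hgen, hst⟩ := hD x
  exact ⟨f, hf, D.exists_generators_of_away f (MvPolynomial.X (Fin.last n)) (poleExponent ρ)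
    (D.inverseImage (DiffMap.away _ f)) (D.inverseImage_nabla_one_tmul fun k i => rfl)
    hfg hgen hst⟩

end BoundedLattice

/-! ### Lattices in modules of homomorphisms. -/

section HomLattice

/-- Generators, up to the operators `∇_i`, of a lattice in a module of homomorphisms. The maps
`ev j` are evaluations at generators of the source which are killed by the `∇_i`, and `P` is a
lattice in the target stable under `g ^ k ∇_i`. -/
theorem exists_generators_of_lattice {B H Q I J : Type*} [Fintype J] [CommRing B] [Algebra ℂ B]
    [AddCommGroup H] [Module B H] [AddCommGroup Q] [Module B Q] {A : Subalgebra ℂ B}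
    [IsNoetherianRing A] (ev : J → H →ₗ[B] Q) (hev : ∀ φ, (∀ j, ev j φ = 0) → φ = 0)
    {P : Submodule A Q} (hP : P.FG) (nab : I → H →+ H) (nabQ : I → Q →+ Q)
    (hnab : ∀ i j φ, ev j (nab i φ) = nabQ i (ev j φ)) {g T : B} (hg : g ∈ A) (hT : T ∈ A)
    (hTbij : Function.Bijective fun φ : H => T • φ)
    (hTnab : ∀ i φ, nab i (T • φ) = T • nab i φ) {k : ℕ}
    (hPnab : ∀ i, ∀ q ∈ P, g ^ k • nabQ i q ∈ P) (hPex : ∀ q, ∃ l : ℕ, (g * T) ^ l • q ∈ P)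
    (v : Finset H) : ∃ (m : ℕ) (e : Fin m → H),
      (∀ w ∈ v, ∃ l : ℕ, g ^ l • w ∈ Submodule.span B (Set.range e)) ∧
      ∀ i j, g ^ k • nab i (e j) ∈ Submodule.span A (Set.range e) := by
  let Λ : Submodule A H := ⨅ j, P.comap ((ev j).restrictScalars A)
  have hΛ : ∀ φ, φ ∈ Λ ↔ ∀ j, ev j φ ∈ P := fun φ => by
    simp only [Λ, Submodule.mem_iInf, Submodule.mem_comap, LinearMap.restrictScalars_apply]
  -- Evaluation at the generators embeds `Λ` in a finite power of `P`, which is noetherian over `A`.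
  have hfg : Λ.FG := by
    have := isNoetherian_of_fg_of_noetherian P hP
    let F : Λ →ₗ[A] (J → P) := LinearMap.pi fun j =>
      (((ev j).restrictScalars A).restrict (p := Λ) (q := P) fun φ hφ => (hΛ φ).mp hφ j)
    have hF : Function.Injective F := by
      rw [injective_iff_map_eq_zero]
      intro φ hφ
      exact Subtype.ext (hev _ fun j => congrArg Subtype.val (congrFun hφ j))
    have := Module.Finite.of_injective F hF
    exact Module.Finite.iff_fg.mp this
  have hpow : ∀ {l l' : ℕ}, l ≤ l' → ∀ {q : Q}, (g * T) ^ l • q ∈ P → (g * T) ^ l' • q ∈ P := by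
    intro l l' h q hq
    rw [← Nat.sub_add_cancel h, pow_add, mul_smul]
    exact P.smul_mem (⟨_, A.pow_mem (A.mul_mem hg hT) _⟩ : A) hq
  have hex : ∀ w : H, ∃ l : ℕ, ∀ l' ≥ l, (g * T) ^ l' • w ∈ Λ := by
    intro w
    choose l hl using fun j => hPex (ev j w)
    refine ⟨∑ j, l j, fun l' hl' => (hΛ _).mpr fun j => ?_⟩
    rw [map_smul]
    exact hpow ((Finset.single_le_sum (f := l) (fun _ _ => Nat.zero_le _)
      (Finset.mem_univ j)).trans hl') (hl j)
  choose l hl using hex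
  -- One exponent serves all of the finite set `v`: `(g T) ^ N` carries each of its elements into
  -- `Λ`.
  set N := v.sup l with hN
  obtain ⟨m, lam, hlam⟩ := Submodule.fg_iff_exists_fin_generating_family.mp hfg
  have hTN : ∀ N : ℕ, Function.Bijective fun φ : H => T ^ N • φ := by
    intro N
    induction N with
    | zero =>
      simp only [pow_zero, one_smul]
      exact Function.bijective_id
    | succ N ih =>
      have := ih.comp hTbij
      simpa only [Function.comp_def, smul_smul, ← pow_succ] using this
  have hTNnab : ∀ (N : ℕ) i φ, nab i (T ^ N • φ) = T ^ N • nab i φ := by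
    intro N i φ
    induction N with
    | zero => simp
    | succ N ih => rw [pow_succ', mul_smul, hTnab, ih, mul_smul]
  choose e he using fun j => (hTN N).2 (lam j)
  replace he : ∀ j, T ^ N • e j = lam j := he
  have hspan : ∀ w, T ^ N • w ∈ Λ → w ∈ Submodule.span A (Set.range e) := by
    intro w hw
    rw [← hlam, Submodule.mem_span_range_iff_exists_fun] at hw
    obtain ⟨c, hc⟩ := hw
    refine (Submodule.mem_span_range_iff_exists_fun _).mpr ⟨c, (hTN N).1 ?_⟩
    change T ^ N • _ = T ^ N • w
    rw [← hc, Finset.smul_sum]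
    refine Finset.sum_congr rfl fun j _ => ?_
    rw [smul_comm, ← he]
  refine ⟨m, e, fun w hw => ⟨N, ?_⟩, fun i j => hspan _ ?_⟩
  · have h1 := hl w N (Finset.le_sup hw)
    rw [mul_comm g, mul_pow, mul_smul] at h1
    exact Submodule.span_le_restrictScalars A B _ (hspan _ h1)
  · rw [smul_comm, ← hTNnab, he j, hΛ]
    intro j'
    rw [map_smul, hnab]
    refine hPnab i _ ((hΛ _).mp ?_ j')
    rw [← hlam]
    exact Submodule.subset_span ⟨j, rfl⟩

end HomLattice

/-! ### The geometry of the dilatation -/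

theorem MvPolynomial.pderiv_comm {σ K : Type*} [CommRing K] (k l : σ) (p : MvPolynomial σ K) :
    MvPolynomial.pderiv k (MvPolynomial.pderiv l p) =
      MvPolynomial.pderiv l (MvPolynomial.pderiv k p) := by
  classical
  have h : ⁅(MvPolynomial.pderiv k : Derivation K (MvPolynomial σ K) (MvPolynomial σ K)),
      (MvPolynomial.pderiv l : Derivation K (MvPolynomial σ K) (MvPolynomial σ K))⁆ = 0 := by
    refine MvPolynomial.derivation_ext fun i => ?_
    rw [Derivation.commutator_apply, MvPolynomial.pderiv_X, MvPolynomial.pderiv_X, Pi.single_apply, Pi.single_apply]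
    split_ifs <;> simp
  have := DFunLike.congr_fun h p
  rwa [Derivation.commutator_apply, Derivation.zero_apply, sub_eq_zero] at this

section Dilatation

open MvPolynomial

variable (n a : ℕ)

/-- The coordinate `x_i = t_i + t_n ^ (a + δ_{i n}) y_i` as a function on the vector bundle. -/
noncomputable def dilatationCoord (i : Fin (n + 1)) : BundleRing (n + 1) (n + 1) :=
  X (Sum.inl i) + X (Sum.inl (Fin.last n)) ^ poleExponent a i * X (Sum.inr i)

/-- Restriction of functions from the vector bundle to `U × U`. -/
noncomputable def toOpen : BundleRing (n + 1) (n + 1) →ₐ[ℂ] OpenRing n a :=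
  (openMap n a).comp (dilatationMap n a)

theorem dilatationCoord_last : dilatationCoord n a (Fin.last n) =
    dilatationUnit n a * X (Sum.inl (Fin.last n)) := by
  simp only [dilatationCoord, dilatationUnit, poleExponent, if_true]
  ring

theorem openDerivation_toOpen (k : Fin (n + 1) ⊕ Fin (n + 1)) (b : BundleRing (n + 1) (n + 1)) :
    openDerivation n a k (toOpen n a b) = toOpen n a (pderiv k b) :=
  (awayDerivation_algebraMap _ _ _).trans
    (congrArg (openMap n a) (awayDerivation_algebraMap _ (pderiv k) b))

theorem dilatationDerivation_comm (k l : Fin (n + 1) ⊕ Fin (n + 1)) (s : DilatationRing n a) :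
    dilatationDerivation n a k (dilatationDerivation n a l s) =
      dilatationDerivation n a l (dilatationDerivation n a k s) :=
  awayDerivation_comm (d₁ := pderiv k) (d₂ := pderiv l) (dilatationUnit n a)
    (MvPolynomial.pderiv_comm k l) s

theorem openDerivation_comm (k l : Fin (n + 1) ⊕ Fin (n + 1)) (s : OpenRing n a) :
    openDerivation n a k (openDerivation n a l s) = openDerivation n a l (openDerivation n a k s) :=
  awayDerivation_comm (secondCoord n a (Fin.last n)) (dilatationDerivation_comm n a k l) s

theorem firstProj_toAlgHom (p : AffineRing (n + 1)) :
    (firstProj n a).toAlgHom p = toOpen n a (aeval (dilatationCoord n a) p) := by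
  rw [← AlgHom.comp_apply, comp_aeval]
  rfl

theorem secondProj_toAlgHom (p : AffineRing (n + 1)) :
    (secondProj n a).toAlgHom p = toOpen n a (aeval (fun i => X (Sum.inl i)) p) := by
  rw [← AlgHom.comp_apply, comp_aeval]
  rfl

theorem isUnit_toOpen_dilatationUnit : IsUnit (toOpen n a (dilatationUnit n a)) :=
  (IsLocalization.Away.algebraMap_isUnit (S := DilatationRing n a) (dilatationUnit n a)).map
    (openMap n a)

theorem isUnit_toOpen_X : IsUnit (toOpen n a (X (Sum.inl (Fin.last n)))) :=
  IsLocalization.Away.algebraMap_isUnit (S := OpenRing n a) (secondCoord n a (Fin.last n))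

/-- The ring of `U × U` is obtained by inverting `u` and then `t_n`, hence by inverting the single
function `u t_n`, which is the coordinate `x_n`. -/
theorem exists_pow_mul_eq_toOpen (s : OpenRing n a) : ∃ (k : ℕ) (b : BundleRing (n + 1) (n + 1)),
    toOpen n a (dilatationUnit n a * X (Sum.inl (Fin.last n))) ^ k * s = toOpen n a b := by
  obtain ⟨k, r, hr⟩ := IsLocalization.Away.surj (secondCoord n a (Fin.last n)) s
  obtain ⟨l, b, hb⟩ := IsLocalization.Away.surj (dilatationUnit n a) r
  refine ⟨k + l, dilatationUnit n a ^ k * X (Sum.inl (Fin.last n)) ^ l * b, ?_⟩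
  have h1 : s * toOpen n a (X (Sum.inl (Fin.last n))) ^ k = openMap n a r := hr
  have h2 : openMap n a r * toOpen n a (dilatationUnit n a) ^ l = toOpen n a b := by
    refine Eq.trans ?_ (congrArg (openMap n a) hb)
    rw [map_mul, map_pow]
    rfl
  rw [map_mul, map_mul, map_mul, map_pow, map_pow, ← h2, ← h1]
  ring

/-- The subring generated by the `t_i`, the `t_n ^ (a + δ_{i n}) y_i` and `t_n ^ a y_n`. -/
noncomputable def dilatationSubalgebra : Subalgebra ℂ (BundleRing (n + 1) (n + 1)) :=
  Algebra.adjoin ℂ (Set.range (fun i => X (Sum.inl i)) ∪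
    (Set.range (fun i => X (Sum.inl (Fin.last n)) ^ poleExponent a i * X (Sum.inr i)) ∪
      {X (Sum.inl (Fin.last n)) ^ a * X (Sum.inr (Fin.last n))}))

/-- A finitely generated algebra over a field is noetherian. This is the reason for working with
polynomials in specified generators and not with all functions of small degree. -/
instance : IsNoetherianRing (dilatationSubalgebra n a) := by
  have h : (dilatationSubalgebra n a).FG :=
    ⟨((Set.finite_range _).union ((Set.finite_range _).union (Set.finite_singleton _))).toFinset,
      by rw [Set.Finite.coe_toFinset]; rfl⟩
  have := (Subalgebra.fg_iff_finiteType _).mp h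
  exact Algebra.FiniteType.isNoetherianRing ℂ _

theorem X_mem_dilatationSubalgebra (i : Fin (n + 1)) :
    X (Sum.inl i) ∈ dilatationSubalgebra n a :=
  Algebra.subset_adjoin (Or.inl ⟨i, rfl⟩)

theorem X_pow_mul_X_mem_dilatationSubalgebra (i : Fin (n + 1)) :
    X (Sum.inl (Fin.last n)) ^ poleExponent a i * X (Sum.inr i) ∈ dilatationSubalgebra n a :=
  Algebra.subset_adjoin (Or.inr (Or.inl ⟨i, rfl⟩))

theorem aeval_dilatationCoord_mem (p : AffineRing (n + 1)) :
    aeval (dilatationCoord n a) p ∈ dilatationSubalgebra n a := by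
  have h : ∀ i, dilatationCoord n a i ∈ dilatationSubalgebra n a := fun i =>
    add_mem (X_mem_dilatationSubalgebra n a i) (X_pow_mul_X_mem_dilatationSubalgebra n a i)
  induction p using MvPolynomial.induction_on with
  | C c =>
    rw [aeval_C]
    exact Subalgebra.algebraMap_mem _ c
  | add p q hp hq =>
    rw [map_add]
    exact add_mem hp hq
  | mul_X p i hp =>
    rw [map_mul, aeval_X]
    exact mul_mem hp (h i)

/-- The generator `t_n ^ a y_n` is present for this purpose: `t_n ^ (a + 1) y_n` alone would give
`x_n` but not `u`. -/
theorem dilatationUnit_mem : dilatationUnit n a ∈ dilatationSubalgebra n a :=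
  add_mem (one_mem _) (Algebra.subset_adjoin (Or.inr (Or.inr rfl)))

theorem pderiv_mem_dilatationSubalgebra (i : Fin (n + 1)) {b : BundleRing (n + 1) (n + 1)}
    (hb : b ∈ dilatationSubalgebra n a) : pderiv (Sum.inr i) b ∈ dilatationSubalgebra n a := by
  classical
  have hX : ∀ k j, pderiv (R := ℂ) (Sum.inr i)
      (X (Sum.inl (Fin.last n)) ^ k * X (Sum.inr j) : BundleRing (n + 1) (n + 1)) ∈
        dilatationSubalgebra n a := by
    intro k j
    have h0 : pderiv (R := ℂ) (Sum.inr i)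
        (X (Sum.inl (Fin.last n)) : BundleRing (n + 1) (n + 1)) = 0 :=
      pderiv_X_of_ne (by simp)
    rw [pderiv_mul, pderiv_pow, h0, mul_zero, zero_mul, zero_add, pderiv_X, Pi.single_apply]
    refine mul_mem (pow_mem (X_mem_dilatationSubalgebra n a _) _) ?_
    split_ifs
    · exact one_mem _
    · exact zero_mem _
  induction hb using Algebra.adjoin_induction with
  | mem b hb =>
    rcases hb with ⟨j, rfl⟩ | ⟨j, rfl⟩ | rfl
    · simp only
      rw [pderiv_X_of_ne (by simp)]
      exact zero_mem _
    · exact hX _ _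
    · exact hX _ _
  | algebraMap c =>
    rw [Derivation.map_algebraMap]
    exact zero_mem _
  | add b c _ _ hb hc =>
    rw [map_add]
    exact add_mem hb hc
  | mul b c hb' hc' hb hc =>
    rw [pderiv_mul]
    exact add_mem (mul_mem hb hc') (mul_mem hb' hc)

/-- Each `y_i` enters the subring after multiplication by `t_n ^ (a + δ_{in})`. -/
theorem exists_pow_mul_mem_dilatationSubalgebra (b : BundleRing (n + 1) (n + 1)) :
    ∃ k : ℕ, X (Sum.inl (Fin.last n)) ^ k * b ∈ dilatationSubalgebra n a := by
  have hT := fun k : ℕ => pow_mem (X_mem_dilatationSubalgebra n a (Fin.last n)) k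
  induction b using MvPolynomial.induction_on with
  | C c => exact ⟨0, mul_mem (hT 0) (Subalgebra.algebraMap_mem _ c)⟩
  | add p q hp hq =>
    obtain ⟨k, hk⟩ := hp
    obtain ⟨l, hl⟩ := hq
    refine ⟨k + l, ?_⟩
    have h := add_mem (mul_mem (hT l) hk) (mul_mem (hT k) hl)
    convert h using 1
    ring
  | mul_X p i hp =>
    obtain ⟨k, hk⟩ := hp
    rcases i with i | i
    · refine ⟨k, ?_⟩
      rw [← mul_assoc]
      exact mul_mem hk (X_mem_dilatationSubalgebra n a i)
    · refine ⟨k + poleExponent a i, ?_⟩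
      have h := mul_mem hk (X_pow_mul_X_mem_dilatationSubalgebra n a i)
      convert h using 1
      ring

variable {n a} (ha : 1 ≤ a) {x : Fin (n + 1) → ℂ} (hx : x (Fin.last n) = 0)

include ha hx

/-- Small degree passes to sums and products, so the generators decide. As `x` lies on the divisor,
`t_n` has no constant term at `x`, and `a ≥ 1` gives each generator of degree one in `y` a positive
order in `t`. -/
theorem hasSmallDegree_of_mem_dilatationSubalgebra {b : BundleRing (n + 1) (n + 1)}
    (hb : b ∈ dilatationSubalgebra n a) :
    HasSmallDegree ((completionMap (n + 1) (n + 1) x).toAlgHom b) := by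
  set φ := (completionMap (n + 1) (n + 1) x).toAlgHom with hφ
  have hl : ∀ i, φ (X (Sum.inl i)) =
      C (MvPowerSeries.C (x i) + MvPowerSeries.X i) := fun i => aeval_X _ _
  have hr : ∀ i, φ (X (Sum.inr i)) = X i := fun i => aeval_X _ _
  have hle : dilatationSubalgebra n a ≤ (smallDegreeSubalgebra (n + 1) (n + 1)).comap φ := by
    refine Algebra.adjoin_le ?_
    rintro _ (⟨i, rfl⟩ | ⟨i, rfl⟩ | rfl)
    · change φ _ ∈ smallDegreeSubalgebra _ _
      simp only
      rw [hl]
      exact C_mem_smallDegreeSubalgebra _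
    · change φ _ ∈ smallDegreeSubalgebra _ _
      simp only
      rw [map_mul, map_pow, hl, hr, hx, map_zero, zero_add]
      refine X_pow_mul_X_mem_smallDegreeSubalgebra ?_ _ _
      rw [poleExponent]
      split_ifs <;> omega
    · change φ _ ∈ smallDegreeSubalgebra _ _
      rw [map_mul, map_pow, hl, hr, hx, map_zero, zero_add]
      exact X_pow_mul_X_mem_smallDegreeSubalgebra ha _ _
  exact hle hb

/-- On the fibre over a point of the divisor, `t_n = 0` makes `u` equal to `1` and each `x_i` equal
to its value at `x`; the product restricts to the nonzero constant `f(x)`. -/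
theorem isUnit_map_completionMap {f : AffineRing (n + 1)} (hf : eval x f ≠ 0) :
    IsUnit (MvPolynomial.map (MvPowerSeries.constantCoeff (σ := Fin (n + 1)) (R := ℂ))
      ((completionMap (n + 1) (n + 1) x).toAlgHom
        (aeval (dilatationCoord n a) f * dilatationUnit n a))) := by
  let F : BundleRing (n + 1) (n + 1) →+* MvPolynomial (Fin (n + 1)) ℂ :=
    (MvPolynomial.map (MvPowerSeries.constantCoeff (σ := Fin (n + 1)) (R := ℂ))).comp
      (completionMap (n + 1) (n + 1) x).toAlgHom.toRingHom
  have hF : ∀ b, F b = MvPolynomial.map (MvPowerSeries.constantCoeff (σ := Fin (n + 1)) (R := ℂ))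
      ((completionMap (n + 1) (n + 1) x).toAlgHom b) := fun b => rfl
  have hl : ∀ i, F (X (Sum.inl i)) = C (x i) := fun i => by
    rw [hF]
    change MvPolynomial.map _ (aeval _ _) = _
    simp
  have hc : ∀ c : ℂ, F (C c) = C c := fun c => by
    rw [hF]
    change MvPolynomial.map _ (aeval _ _) = _
    rw [aeval_C, MvPolynomial.algebraMap_apply, map_C]
    exact congrArg C (MvPowerSeries.constantCoeff_C c)
  have hu : F (dilatationUnit n a) = 1 := by
    rw [dilatationUnit, map_add, map_one, map_mul, map_pow, hl, hx, map_zero,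
      zero_pow (by omega), zero_mul, add_zero]
  have hcoord : ∀ i, F (dilatationCoord n a i) = C (x i) := fun i => by
    rw [dilatationCoord, map_add, map_mul, map_pow, hl, hl, hx, map_zero, zero_pow, zero_mul,
      add_zero]
    rw [poleExponent]
    split_ifs <;> omega
  have hfx : F (aeval (dilatationCoord n a) f) = C (eval x f) := by
    clear hf
    induction f using MvPolynomial.induction_on with
    | C c => rw [aeval_C, algebraMap_eq, hc, eval_C]
    | add p q hp hq => rw [map_add, map_add, hp, hq, map_add, map_add]
    | mul_X p i hp => rw [map_mul, map_mul, hp, aeval_X, hcoord, map_mul, eval_X, map_mul]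
  rw [← hF, map_mul, hu, mul_one, hfx]
  exact (isUnit_iff_ne_zero.mpr hf).map C

end Dilatation

theorem InverseImage.span_tmul_one_eq_top {R S M : Type*} [CommRing R] [Algebra ℂ R] [CommRing S]
    [Algebra ℂ S] [AddCommGroup M] [Module R M] (φ : R →ₐ[ℂ] S) {c : R} (hc : IsUnit (φ c))
    {t : Set M} (ht : ∀ m, ∃ k : ℕ, c ^ k • m ∈ Submodule.span R t) :
    Submodule.span S (tmul φ 1 '' t) = ⊤ := by
  refine eq_top_iff.mpr fun z _ => ?_
  induction z using InverseImage.induction with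
  | h0 => exact Submodule.zero_mem _
  | ha x y hx hy => exact Submodule.add_mem _ (hx trivial) (hy trivial)
  | ht s m =>
    obtain ⟨k, hk⟩ := ht m
    obtain ⟨w, hw⟩ := hc.pow k
    have h := tmul_mem_span φ hk (s * (↑w⁻¹ : S))
    rwa [tmul_smul, map_pow, ← hw, mul_comm s, ← mul_assoc, Units.mul_inv, one_mul] at h

/-! ### Spans in direct images. -/

section DirectImage

variable {R S : Type*} [CommRing R] [Algebra ℂ R] [CommRing S] [Algebra ℂ S]

/-- An element of a module, as an element of its direct image. -/
def DirectImage.of (φ : R →ₐ[ℂ] S) {N : Type*} (z : N) : DirectImage φ N := z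

theorem DirectImage.smul_of (φ : R →ₐ[ℂ] S) {N : Type*} [AddCommGroup N] [Module S N] (r : R)
    (z : N) : r • of φ z = of φ (φ r • z) :=
  rfl

theorem DirectImage.of_add (φ : R →ₐ[ℂ] S) {N : Type*} [AddCommGroup N] (z w : N) :
    of φ (z + w) = of φ z + of φ w :=
  rfl

theorem DirectImage.of_zero (φ : R →ₐ[ℂ] S) {N : Type*} [AddCommGroup N] :
    of φ (0 : N) = 0 :=
  rfl

theorem DirectImage.exists_pow_smul_mem_span (φ : R →ₐ[ℂ] S) {N : Type*} [AddCommGroup N]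
    [Module S N] {f : R} (hf : ∀ s, ∃ (k : ℕ) (b : R), φ f ^ k * s = φ b) {t : Set N}
    {z : N} (hz : z ∈ Submodule.span S t) :
    ∃ k : ℕ, f ^ k • of φ z ∈ Submodule.span R (of φ '' t) := by
  induction hz using Submodule.span_induction with
  | mem x hx => exact ⟨0, Submodule.smul_mem _ _ (Submodule.subset_span ⟨x, hx, rfl⟩)⟩
  | zero => exact ⟨0, Submodule.smul_mem _ _ (Submodule.zero_mem _)⟩
  | add x y _ _ hx hy =>
    obtain ⟨k, hk⟩ := hx
    obtain ⟨l, hl⟩ := hy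
    refine ⟨k + l, ?_⟩
    have h := Submodule.add_mem _ (Submodule.smul_mem _ (f ^ l) hk)
      (Submodule.smul_mem _ (f ^ k) hl)
    rwa [smul_smul, smul_smul, ← pow_add, ← pow_add, add_comm l, ← smul_add] at h
  | smul s x _ hx =>
    obtain ⟨k, hk⟩ := hx
    obtain ⟨l, b, hb⟩ := hf s
    refine ⟨l + k, ?_⟩
    have h := Submodule.smul_mem _ b hk
    rw [smul_smul, smul_of, map_mul, ← hb] at h
    rw [smul_of, smul_smul]
    convert h using 3
    rw [map_pow, map_pow]
    ring

end DirectImage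

/-! ### The lattice in the inverse image and its stability. -/

section Lattice

variable {R B S M ι : Type*} [CommRing R] [Algebra ℂ R] [CommRing B] [Algebra ℂ B] [CommRing S]
  [Algebra ℂ S] [AddCommGroup M] [Module R M]

/-- The lattice in the inverse image of `M` under `φ` which is spanned over the subring `A` by
sections of `M`; here the inverse image is viewed over the ring `B` by means of `ψ`. -/
def inverseImageLattice (φ : R →ₐ[ℂ] S) (ψ : B →ₐ[ℂ] S) (A : Subalgebra ℂ B) (v : ι → M) :
    Submodule A (DirectImage ψ (InverseImage φ M)) :=
  Submodule.span A (Set.range fun j => DirectImage.of ψ (InverseImage.tmul φ 1 (v j)))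

variable {φ : R →ₐ[ℂ] S} {ψ : B →ₐ[ℂ] S} {A : Subalgebra ℂ B} {v : ι → M} {π : R →ₐ[ℂ] B}

theorem smul_mem_inverseImageLattice {b : B} (hb : b ∈ A)
    {q : DirectImage ψ (InverseImage φ M)} (hq : q ∈ inverseImageLattice φ ψ A v) :
    b • q ∈ inverseImageLattice φ ψ A v :=
  (inverseImageLattice φ ψ A v).smul_mem (⟨b, hb⟩ : A) hq

theorem smul_of_one_tmul (hφ : ∀ p, φ p = ψ (π p)) (p : R) (m : M) :
    π p • DirectImage.of ψ (InverseImage.tmul φ 1 m) =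
      DirectImage.of ψ (InverseImage.tmul φ 1 (p • m)) := by
  rw [← InverseImage.smul_tmul_one, hφ, DirectImage.smul_of]

theorem of_one_tmul_mem_inverseImageLattice (hφ : ∀ p, φ p = ψ (π p)) (hA : ∀ p, π p ∈ A) {m : M}
    (hm : m ∈ Submodule.span R (Set.range v)) :
    DirectImage.of ψ (InverseImage.tmul φ 1 m) ∈ inverseImageLattice φ ψ A v := by
  induction hm using Submodule.span_induction with
  | mem x hx =>
    obtain ⟨j, rfl⟩ := hx
    exact Submodule.subset_span ⟨j, rfl⟩
  | zero =>
    rw [InverseImage.tmul_zero]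
    exact (inverseImageLattice φ ψ A v).zero_mem
  | add x y _ _ hx hy =>
    rw [InverseImage.tmul_add]
    exact (inverseImageLattice φ ψ A v).add_mem hx hy
  | smul p x _ hx =>
    rw [← smul_of_one_tmul hφ]
    exact smul_mem_inverseImageLattice (hA p) hx

theorem exists_pow_smul_mem_inverseImageLattice (hφ : ∀ p, φ p = ψ (π p)) (hA : ∀ p, π p ∈ A)
    {u T : B} (hu : u ∈ A) (hT : T ∈ A) (hS : ∀ s, ∃ (k : ℕ) (b : B), ψ (u * T) ^ k * s = ψ b)
    (hB : ∀ b, ∃ k : ℕ, T ^ k * b ∈ A) {f X : R} (hX : π X = u * T)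
    (hv : ∀ m, ∃ k : ℕ, (f * X) ^ k • m ∈ Submodule.span R (Set.range v))
    (q : InverseImage φ M) :
    ∃ l : ℕ, (π f * u * T) ^ l • DirectImage.of ψ q ∈ inverseImageLattice φ ψ A v := by
  have hpow : ∀ l, (π f * u * T) ^ l ∈ A := fun l => pow_mem (mul_mem (mul_mem (hA f) hu) hT) l
  induction q using InverseImage.induction with
  | h0 =>
    exact ⟨0, by rw [DirectImage.of_zero, smul_zero]; exact (inverseImageLattice φ ψ A v).zero_mem⟩
  | ha x y hx hy =>
    obtain ⟨k, hk⟩ := hx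
    obtain ⟨l, hl⟩ := hy
    refine ⟨k + l, ?_⟩
    have h := (inverseImageLattice φ ψ A v).add_mem (smul_mem_inverseImageLattice (hpow l) hk)
      (smul_mem_inverseImageLattice (hpow k) hl)
    rwa [smul_smul, smul_smul, ← pow_add, ← pow_add, add_comm l, ← smul_add,
      ← DirectImage.of_add] at h
  | ht s m =>
    obtain ⟨k, b, hb⟩ := hS s
    obtain ⟨k', hk'⟩ := hB b
    obtain ⟨k'', hk''⟩ := hv m
    refine ⟨k + k' + k'', ?_⟩
    -- Here `k` powers of `u T` bring `s` into the image of `B`, `k'` powers of `T` bring the result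
    -- into `A`, and `k''` powers of `f X` bring `m` into the span; the other factors pad these to a
    -- power of `π f * u * T`.
    have h1 := smul_mem_inverseImageLattice (mul_mem (mul_mem (pow_mem (hA f) k)
      (pow_mem (mul_mem (hA f) hu) k')) hk') (of_one_tmul_mem_inverseImageLattice hφ hA hk'')
    rw [← smul_of_one_tmul hφ, smul_smul, map_pow, map_mul, hX, DirectImage.smul_of,
      InverseImage.smul_tmul] at h1
    rw [DirectImage.smul_of, InverseImage.smul_tmul]
    convert h1 using 3
    simp only [map_mul, map_pow, ← hb]
    ring

/-- The factor `T ^ p'` produced by the chain rule absorbs the pole: since `X` pulls back to `u T`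
and `p ≤ p'`, only powers of `u` and `f` remain to be cleared. Stability of `A` under `d i` extends
this from the generators to their span. -/
theorem pow_smul_nabla_mem_inverseImageLattice {κ : Type*} (hφ : ∀ p, φ p = ψ (π p))
    (hA : ∀ p, π p ∈ A) {u T : B} (hu : u ∈ A) (hT : T ∈ A) {f X : R} (hX : π X = u * T)
    {d : κ → Derivation ℂ B B} (D' : Connection d (DirectImage ψ (InverseImage φ M))) (i : κ)
    (hd : ∀ b ∈ A, d i b ∈ A) (nab : M → M) {p p' k l : ℕ}
    (hD' : ∀ m, D'.nabla i (DirectImage.of ψ (InverseImage.tmul φ 1 m)) =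
      T ^ p' • DirectImage.of ψ (InverseImage.tmul φ 1 (nab m)))
    (hk : ∀ j, (f ^ k * X ^ p) • nab (v j) ∈ Submodule.span R (Set.range v)) (hp : p ≤ p')
    (hl : k + p ≤ l) {q : DirectImage ψ (InverseImage φ M)}
    (hq : q ∈ inverseImageLattice φ ψ A v) :
    (π f * u) ^ l • D'.nabla i q ∈ inverseImageLattice φ ψ A v := by
  induction hq using Submodule.span_induction with
  | mem x hx =>
    obtain ⟨j, rfl⟩ := hx
    obtain ⟨c, rfl⟩ : ∃ c, p' = p + c := Nat.exists_eq_add_of_le hp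
    obtain ⟨c', rfl⟩ : ∃ c', l = k + p + c' := Nat.exists_eq_add_of_le hl
    have h2 := smul_mem_inverseImageLattice (mul_mem (mul_mem (pow_mem (hA f) (p + c'))
      (pow_mem hu (k + c'))) (pow_mem hT c)) (of_one_tmul_mem_inverseImageLattice hφ hA (hk j))
    rw [← smul_of_one_tmul hφ, smul_smul, map_mul, map_pow, map_pow, hX] at h2
    simp only
    rw [hD', smul_smul]
    convert h2 using 2
    ring
  | zero =>
    rw [map_zero, smul_zero]
    exact (inverseImageLattice φ ψ A v).zero_mem
  | add x y _ _ hx hy =>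
    rw [map_add, smul_add]
    exact (inverseImageLattice φ ψ A v).add_mem hx hy
  | smul b x hx' hx =>
    have h1 : D'.nabla i (b • x) = d i b.1 • x + b.1 • D'.nabla i x := D'.leibniz i b.1 x
    rw [h1, smul_add, smul_comm _ b.1]
    exact (inverseImageLattice φ ψ A v).add_mem
      (smul_mem_inverseImageLattice (pow_mem (mul_mem (hA f) hu) _)
        (smul_mem_inverseImageLattice (hd b.1 b.2) hx'))
      (smul_mem_inverseImageLattice b.2 hx)

end Lattice

/-! ### The `y`-derivatives of sections pulled back by the two projections. -/

section Projections

open MvPolynomial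

variable {n a : ℕ} {M : Type*} [AddCommGroup M] [Module (AffineRing (n + 1)) M]

/-- Among the first coordinates only `x_i = t_i + t_n ^ (a + δ_{in}) y_i` depends on `y_i`. -/
theorem nabla_one_tmul_firstProj (D : Connection (fun i : Fin (n + 1) => pderiv (R := ℂ) i) M)
    (i : Fin (n + 1)) (m : M) :
    DirectImage.of (toOpen n a) ((D.inverseImage (firstProj n a)).nabla (Sum.inr i)
      (InverseImage.tmul (firstProj n a).toAlgHom 1 m)) =
    ((X (Sum.inl (Fin.last n)) : BundleRing (n + 1) (n + 1)) ^ poleExponent a i) •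
      DirectImage.of (toOpen n a)
        (InverseImage.tmul (firstProj n a).toAlgHom 1 (D.nabla i m)) := by
  classical
  have hjac : ∀ l, (firstProj n a).jac (Sum.inr i) l =
      if l = i then toOpen n a (X (Sum.inl (Fin.last n)) ^ poleExponent a i) else 0 := by
    intro l
    refine (openDerivation_toOpen n a (Sum.inr i) (dilatationCoord n a l)).trans ?_
    have h0 : ∀ j, pderiv (R := ℂ) (Sum.inr i) (X (Sum.inl j) : BundleRing (n + 1) (n + 1)) = 0 :=
      fun j => pderiv_X_of_ne (by simp)
    rw [dilatationCoord, map_add, h0, zero_add, pderiv_mul, pderiv_pow, h0, mul_zero, zero_mul,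
      zero_add, pderiv_X, Pi.single_apply]
    by_cases h : l = i
    · simp [h]
    · simp [h]
  rw [D.inverseImage_nabla_tmul, Derivation.map_one_eq_zero, ← InverseImage.tmulHom_apply,
    map_zero, AddMonoidHom.zero_apply, zero_add, Finset.sum_eq_single i]
  · rw [hjac, if_pos rfl, one_mul, InverseImage.eq_smul_tmul_one]
    rfl
  · intro l _ hl
    rw [hjac, if_neg hl, mul_zero, ← InverseImage.tmulHom_apply, map_zero, AddMonoidHom.zero_apply]
  · simp

theorem nabla_one_tmul_secondProj (D : Connection (fun i : Fin (n + 1) => pderiv (R := ℂ) i) M)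
    (i : Fin (n + 1)) (m : M) :
    (D.inverseImage (secondProj n a)).nabla (Sum.inr i)
      (InverseImage.tmul (secondProj n a).toAlgHom 1 m) = 0 := by
  have hjac : ∀ l, (secondProj n a).jac (Sum.inr i) l = 0 := by
    intro l
    refine (openDerivation_toOpen n a (Sum.inr i) (X (Sum.inl l))).trans ?_
    rw [pderiv_X_of_ne (by simp), map_zero]
  rw [D.inverseImage_nabla_tmul, Derivation.map_one_eq_zero]
  simp only [hjac, mul_zero, ← InverseImage.tmulHom_apply, map_zero, AddMonoidHom.zero_apply,
    Finset.sum_const_zero, add_zero]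

end Projections

/-! ### Property `L` for the dilatation -/

section Main

open MvPolynomial

theorem Connection.nabla_smul_of_eq_zero {ι R N : Type*} [CommRing R] [Algebra ℂ R]
    [AddCommGroup N] [Module R N] {d : ι → Derivation ℂ R R} (D : Connection d N) {i : ι} {r : R}
    (h : d i r = 0) (m : N) : D.nabla i (r • m) = r • D.nabla i m := by
  rw [D.leibniz, h, zero_smul, zero_add]

theorem bijective_smul_directImage {R S N : Type*} [CommRing R] [Algebra ℂ R] [CommRing S]
    [Algebra ℂ S] [AddCommGroup N] [Module S N] (φ : R →ₐ[ℂ] S) {c : R} (hc : IsUnit (φ c)) :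
    Function.Bijective fun z : DirectImage φ N => c • z := by
  obtain ⟨w, hw⟩ := hc
  have h : (fun z : DirectImage φ N => c • z) = fun z => DirectImage.of φ ((w : S) • (z : N)) := by
    funext z
    rw [hw]
    rfl
  rw [h]
  exact (MulAction.bijective (β := N) w)

theorem DirectImage.exists_pow_smul_mem_span_range {ι R S N : Type*} [CommRing R] [Algebra ℂ R]
    [CommRing S] [Algebra ℂ S] [AddCommGroup N] [Module S N] (φ : R →ₐ[ℂ] S) {f : R}
    (hf : ∀ s, ∃ (k : ℕ) (b : R), φ f ^ k * s = φ b) {e : ι → N}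
    (he : Submodule.span S (Set.range e) = ⊤) (z : DirectImage φ N) :
    ∃ k : ℕ, f ^ k • z ∈ Submodule.span R (Set.range fun j => of φ (e j)) := by
  have hz : (id z : N) ∈ Submodule.span S (Set.range e) := he ▸ Submodule.mem_top
  have h := exists_pow_smul_mem_span φ hf hz
  rw [← Set.range_comp] at h
  exact h

/-- Evaluation at an element, as a linear map between direct images. -/
def DirectImage.eval {B S N₂ N₁ : Type*} [CommRing B] [Algebra ℂ B] [CommRing S] [Algebra ℂ S]
    [AddCommGroup N₂] [Module S N₂] [AddCommGroup N₁] [Module S N₁] (ψ : B →ₐ[ℂ] S) (z : N₂) :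
    DirectImage ψ (N₂ →ₗ[S] N₁) →ₗ[B] DirectImage ψ N₁ where
  toFun := fun (u : N₂ →ₗ[S] N₁) => DirectImage.of ψ (u z)
  map_add' _ _ := rfl
  map_smul' _ _ := rfl

/-- At a horizontal element the correction term of the connection on `Hom` vanishes. -/
theorem DirectImage.eval_nabla {ι B S N₂ N₁ : Type*} [CommRing B] [Algebra ℂ B] [CommRing S]
    [Algebra ℂ S] [AddCommGroup N₂] [Module S N₂] [AddCommGroup N₁] [Module S N₁] (ψ : B →ₐ[ℂ] S)
    {d : ι → Derivation ℂ B B} {θ : ι → Derivation ℂ S S} (D₂ : Connection θ N₂)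
    (D₁ : Connection θ N₁) (h : ∀ i r, θ i (ψ r) = ψ (d i r)) {i : ι} {z : N₂}
    (hz : D₂.nabla i z = 0) (u : DirectImage ψ (N₂ →ₗ[S] N₁)) :
    eval ψ z (((D₂.hom D₁).directImage ψ h).nabla i u) =
      (D₁.directImage ψ h).nabla i (eval ψ z u) := by
  let u' : N₂ →ₗ[S] N₁ := u
  change D₁.nabla i (u' z) - u' (D₂.nabla i z) = D₁.nabla i (u' z)
  rw [hz, map_zero, sub_zero]

theorem DirectImage.eq_zero_of_eval {B S N₂ N₁ : Type*} [CommRing B] [Algebra ℂ B] [CommRing S]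
    [Algebra ℂ S] [AddCommGroup N₂] [Module S N₂] [AddCommGroup N₁] [Module S N₁] (ψ : B →ₐ[ℂ] S)
    {t : Set N₂} (ht : Submodule.span S t = ⊤) (u : DirectImage ψ (N₂ →ₗ[S] N₁))
    (h : ∀ z ∈ t, eval ψ z u = 0) : u = 0 :=
  LinearMap.ext_on (f := (id u : N₂ →ₗ[S] N₁)) (g := 0) ht h

variable {n a : ℕ} {M : Type*} [AddCommGroup M] [Module (AffineRing (n + 1)) M]
  {D : Connection (fun i : Fin (n + 1) => pderiv (R := ℂ) i) M}

theorem Connection.IsIntegrable.inverseImage_ofPoly (hD : D.IsIntegrable)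
    (c : Fin (n + 1) → OpenRing n a) :
    (D.inverseImage (DiffMap.ofPoly (openDerivation n a) c)).IsIntegrable :=
  hD.inverseImage _ (openDerivation_comm n a) fun k l i => openDerivation_comm n a k l (c i)

/-- The connection `Hom(p_2^+ M, p_1^+ M)` over the ring of functions of the vector bundle. -/
noncomputable abbrev Connection.bundleHom (a : ℕ)
    (D : Connection (fun i : Fin (n + 1) => pderiv (R := ℂ) i) M) :
    Connection (fun i : Fin (n + 1) ⊕ Fin (n + 1) => pderiv (R := ℂ) i)
      (DirectImage (toOpen n a) (InverseImage (secondProj n a).toAlgHom M →ₗ[OpenRing n a]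
        InverseImage (firstProj n a).toAlgHom M)) :=
  ((D.inverseImage (secondProj n a)).hom (D.inverseImage (firstProj n a))).directImage
    (toOpen n a) (openDerivation_toOpen n a)

/-- The connection `p_1^+ M` over the ring of functions of the vector bundle. -/
noncomputable abbrev Connection.bundleFirst (a : ℕ)
    (D : Connection (fun i : Fin (n + 1) => pderiv (R := ℂ) i) M) :
    Connection (fun i : Fin (n + 1) ⊕ Fin (n + 1) => pderiv (R := ℂ) i)
      (DirectImage (toOpen n a) (InverseImage (firstProj n a).toAlgHom M)) :=
  (D.inverseImage (firstProj n a)).directImage (toOpen n a) (openDerivation_toOpen n a)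

theorem isUnit_firstProj_X :
    IsUnit ((firstProj n a).toAlgHom (X (Fin.last n))) := by
  rw [firstProj_toAlgHom, aeval_X, dilatationCoord_last, map_mul]
  exact (isUnit_toOpen_dilatationUnit n a).mul (isUnit_toOpen_X n a)

theorem isUnit_secondProj_X :
    IsUnit ((secondProj n a).toAlgHom (X (Fin.last n))) := by
  rw [secondProj_toAlgHom, aeval_X]
  exact isUnit_toOpen_X n a

instance : IsNoetherianRing (DilatationRing n a) :=
  IsLocalization.isNoetherianRing (Submonoid.powers (dilatationUnit n a)) _ inferInstance

instance : IsNoetherianRing (OpenRing n a) :=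
  IsLocalization.isNoetherianRing (Submonoid.powers (secondCoord n a (Fin.last n))) _ inferInstance

/-- Both inverse images are finite over the noetherian ring of `U × U`, hence so is their `Hom`.
Over the polynomial ring it is an integrable connection coherent over `𝒪[1/(u t_n)]`, to which
Bernstein's argument applies. -/
theorem Connection.IsMeromorphic.exists_finset_generates_bundleHom (hM : D.IsMeromorphic) :
    ∃ v : Finset (DirectImage (toOpen n a)
      (InverseImage (secondProj n a).toAlgHom M →ₗ[OpenRing n a]
        InverseImage (firstProj n a).toAlgHom M)), (D.bundleHom a).Generates (v : Set _) := by
  obtain ⟨s, hs⟩ := hM.coherent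
  have h1 := InverseImage.span_tmul_one_eq_top (firstProj n a).toAlgHom isUnit_firstProj_X hs
  have h2 := InverseImage.span_tmul_one_eq_top (secondProj n a).toAlgHom isUnit_secondProj_X hs
  have hfin1 : Module.Finite (OpenRing n a) (InverseImage (firstProj n a).toAlgHom M) :=
    ⟨h1 ▸ Submodule.fg_span (s.finite_toSet.image _)⟩
  have hfin2 : Module.Finite (OpenRing n a) (InverseImage (secondProj n a).toAlgHom M) :=
    ⟨h2 ▸ Submodule.fg_span (s.finite_toSet.image _)⟩
  obtain ⟨r, e, he⟩ := Submodule.fg_iff_exists_fin_generating_family.mp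
    (Module.Finite.fg_top (R := OpenRing n a)
      (M := InverseImage (secondProj n a).toAlgHom M →ₗ[OpenRing n a]
        InverseImage (firstProj n a).toAlgHom M))
  refine Connection.exists_finset_generates (D.bundleHom a)
    (((hM.integrable.inverseImage_ofPoly _).hom (hM.integrable.inverseImage_ofPoly _)).directImage
      _ _) (dilatationUnit n a * X (Sum.inl (Fin.last n))) ?_
    (fun j => DirectImage.of (toOpen n a) (e j)) ?_
  · have hu : IsUnit (toOpen n a (dilatationUnit n a * X (Sum.inl (Fin.last n)))) := by
      rw [map_mul]
      exact (isUnit_toOpen_dilatationUnit n a).mul (isUnit_toOpen_X n a)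
    intro z hz
    exact (bijective_smul_directImage (toOpen n a) hu).1 (hz.trans (smul_zero _).symm)
  · exact DirectImage.exists_pow_smul_mem_span_range (toOpen n a) (exists_pow_mul_eq_toOpen n a) he

theorem exists_pow_smul_mem_firstLattice {r : ℕ} {v : Fin r → M} {f : AffineRing (n + 1)}
    (hv : ∀ m, ∃ k : ℕ, (f * X (Fin.last n)) ^ k • m ∈
      Submodule.span (AffineRing (n + 1)) (Set.range v))
    (q : DirectImage (toOpen n a) (InverseImage (firstProj n a).toAlgHom M)) :
    ∃ l : ℕ, (aeval (dilatationCoord n a) f * dilatationUnit n a * X (Sum.inl (Fin.last n))) ^ l •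
      q ∈ inverseImageLattice (firstProj n a).toAlgHom (toOpen n a) (dilatationSubalgebra n a) v :=
  exists_pow_smul_mem_inverseImageLattice (π := aeval (dilatationCoord n a))
    (firstProj_toAlgHom n a) (aeval_dilatationCoord_mem n a) (dilatationUnit_mem n a)
    (X_mem_dilatationSubalgebra n a (Fin.last n)) (exists_pow_mul_eq_toOpen n a)
    (exists_pow_mul_mem_dilatationSubalgebra n a)
    ((aeval_X _ _).trans (dilatationCoord_last n a)) hv q

theorem pow_smul_nabla_mem_firstLattice {ρ : ℕ} (hρ : ρ ≤ a) {r : ℕ} {v : Fin r → M}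
    {f : AffineRing (n + 1)} {k : ℕ}
    (hk : ∀ i j, (f ^ k * X (Fin.last n) ^ poleExponent ρ i) •
        D.nabla i (v j) ∈ Submodule.span (AffineRing (n + 1)) (Set.range v))
    (i : Fin (n + 1)) {q : DirectImage (toOpen n a) (InverseImage (firstProj n a).toAlgHom M)}
    (hq : q ∈ inverseImageLattice (firstProj n a).toAlgHom (toOpen n a)
      (dilatationSubalgebra n a) v) :
    (aeval (dilatationCoord n a) f * dilatationUnit n a) ^ (k + (ρ + 1)) •
      (D.bundleFirst a).nabla (Sum.inr i) q ∈ inverseImageLattice (firstProj n a).toAlgHom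
        (toOpen n a) (dilatationSubalgebra n a) v := by
  have hp : poleExponent ρ i ≤ poleExponent a i := by
    rw [poleExponent, poleExponent]
    split_ifs <;> omega
  have hl : k + poleExponent ρ i ≤ k + (ρ + 1) := by
    rw [poleExponent]
    split_ifs <;> omega
  exact pow_smul_nabla_mem_inverseImageLattice (π := aeval (dilatationCoord n a))
    (firstProj_toAlgHom n a) (aeval_dilatationCoord_mem n a) (dilatationUnit_mem n a)
    (X_mem_dilatationSubalgebra n a (Fin.last n))
    ((aeval_X _ _).trans (dilatationCoord_last n a)) (D.bundleFirst a) (Sum.inr i)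
    (fun b hb => pderiv_mem_dilatationSubalgebra n a i hb) (D.nabla i)
    (nabla_one_tmul_firstProj D i) (hk i) hp hl hq

theorem Connection.propertyLAt_bundleHom {ρ : ℕ} (ha : 1 ≤ a) (hρ : ρ ≤ a)
    (hM : D.IsMeromorphic) (hD : D.IsLocallyGeneratedBounded ρ)
    (x : Fin (n + 1) → ℂ) (hx : x (Fin.last n) = 0) : (D.bundleHom a).PropertyLAt x := by
  classical
  obtain ⟨f, hf, r, v, ⟨k, hk⟩, hv⟩ := hD.exists_generators x
  obtain ⟨w, hw⟩ := hM.exists_finset_generates_bundleHom (a := a)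
  obtain ⟨s, hs⟩ := hM.coherent
  have h2 := InverseImage.span_tmul_one_eq_top (secondProj n a).toAlgHom isUnit_secondProj_X hs
  have hA := aeval_dilatationCoord_mem n a
  have hu := dilatationUnit_mem n a
  have hT := X_mem_dilatationSubalgebra n a (Fin.last n)
  -- The data are `g = f(x_1, …, x_n) u` and `T = t_n`. The evaluations are taken at global
  -- generators of `p_2^+ M`, whereas `P` comes from the local bounded lattice via `p_1`.
  obtain ⟨m, e, he1, he2⟩ := exists_generators_of_lattice
    (A := dilatationSubalgebra n a)
    (fun j : s => DirectImage.eval (toOpen n a)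
      (InverseImage.tmul (secondProj n a).toAlgHom 1 (j : M)))
    (fun φ hφ => DirectImage.eq_zero_of_eval (toOpen n a) h2 φ (by
      rintro _ ⟨m, hm, rfl⟩
      exact hφ ⟨m, hm⟩))
    (P := inverseImageLattice (firstProj n a).toAlgHom (toOpen n a) (dilatationSubalgebra n a) v)
    (Submodule.fg_span (Set.finite_range _))
    (fun i => (D.bundleHom a).nabla (Sum.inr i))
    (fun i => (D.bundleFirst a).nabla (Sum.inr i))
    (fun i j φ => DirectImage.eval_nabla (toOpen n a) _ _ _ (nabla_one_tmul_secondProj D i _) φ)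
    (mul_mem (hA f) hu) hT
    (bijective_smul_directImage (toOpen n a) (isUnit_toOpen_X n a))
    (fun i φ => (D.bundleHom a).nabla_smul_of_eq_zero (pderiv_X_of_ne (by simp)) φ)
    (k := k + (ρ + 1))
    (fun i q hq => pow_smul_nabla_mem_firstLattice hρ hk i hq)
    (exists_pow_smul_mem_firstLattice hv)
    w
  exact (D.bundleHom a).propertyLAt_of_generators x _ (isUnit_map_completionMap ha hx hf)
    (fun b hb => hasSmallDegree_of_mem_dilatationSubalgebra ha hx hb) (mul_mem (hA f) hu) hw e
    he1 _ he2

end Main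

theorem mainTheorem3 (n a ρ : ℕ) (ha : 1 ≤ a) (hρ : ρ ≤ a)
    {M : Type*} [AddCommGroup M] [Module (AffineRing (n + 1)) M]
    (D : Connection (fun i : Fin (n + 1) => MvPolynomial.pderiv (R := ℂ) i) M)
    (hM : D.IsMeromorphic) (hD : D.IsLocallyGeneratedBounded ρ)
    (x : Fin (n + 1) → ℂ) (hx : x (Fin.last n) = 0) :
    (D.dilatationHom a).DilatationPropertyLAt a x :=
  -- Direct image to the dilatation and then to the bundle is, by definition, direct image along the
  -- composite `toOpen`.
  Connection.propertyLAt_bundleHom ha hρ hM hD x hx
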